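/- Fix $1\le p\le 2$, let $1/p+1/p'=1$, and let $v=(0,0,1)\in\mathbb{R}^3$. Let $\Gamma_0\subset\mathbb{R}^3$ be an open conic neighbourhood of $v$ and let $\varphi\in C^\infty(\Gamma_0)$ be positive and positively homogeneous of degree one. Suppose that $$\{\xi\in\Gamma_0:\varphi(\xi)=1\}=\{(x_1,x_2,1+\phi(x_1,x_2)):(x_1,x_2)\in U\},$$ where $U\subset\mathbb{R}^2$ is an open neighbourhood of the origin and $\phi\in C^\infty(U)$ is real-valued with $\phi(0)=0$, $\nabla\phi(0)=0$. Let $F$ be the Fourier transform, $Fu(\xi)=(2\pi)^{-3/2}\int_{\mathbb{R}^3}e^{i\xi\cdot x}u(x)\,dx$. For an open cone $\Gamma$ let $S^{-k}_0(\Gamma)$ be the space of classical (polyhomogeneous) symbols $a\in C^\infty(\mathbb{R}^3)$ of order $-k$ with support in $\Gamma$. Define $k_p(v)$ as the infimum of all $k>0$ for which there is an open conic neighbourhood $\Gamma$ of $v$, on which $\varphi$ is smooth, such that for every $a\in S^{-k}_0(\Gamma)$ the operator $F^{-1}[e^{i\varphi}a]F$ (defined on Schwartz functions) is bounded from $L^p(\mathbb{R}^3)$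 to $L^{p'}(\mathbb{R}^3)$. For a smooth function $f$ near $0\in\mathbb{R}^2$ with $f(0)=0$, $\nabla f(0)=0$, the Newton polyhedron $\mathcal N(f)$ is the convex hull of the union of the octants $\alpha+\mathbb{R}_+^2$ over all $\alpha\in\mathbb{Z}_+^2\setminus\{0\}$ with $\partial^\alpha f(0)\neq0$, and the Newton distance $d(f)$ is the coordinate $d$ of the point $(d,d)$ at which the line $t_1=t_2$ meets the boundary of $\mathcal N(f)$ (with $d(f)=\infty$ if $\mathcal N(f)=\emptyset$). Let $h_{lin}(\phi)=\sup_{T\in GL(\mathbb{R}^2)}d(\phi\circ T)\in[1,\infty]$ be the linear height of $\phi$. Then $$k_p(v)\ \ge\ \left(6-\frac{2}{h_{lin}(\phi)}\right)\left(\frac1p-\frac12\right),$$ where $2/h_{lin}(\phi)=0$ if $h_{lin}(\phi)=\infty$. -/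

import Mathlib

open MeasureTheory
open scoped ContDiff NNReal ENNReal

/-- The Euclidean plane. -/
abbrev Plane : Type := EuclideanSpace ℝ (Fin 2)

/-- The Euclidean space of dimension three. -/
abbrev Space : Type := EuclideanSpace ℝ (Fin 3)

noncomputable section

/-! ### Newton polyhedron, Newton distance, linear height -/

/-- The partial derivative of `f` in the `i`-th coordinate direction. -/
def partialDeriv (i : Fin 2) (f : Plane → ℝ) : Plane → ℝ :=
  fun x => fderiv ℝ f x (EuclideanSpace.single i 1)

/-- The Taylor coefficient at the origin, `∂₁^α₁ ∂₂^α₂ f (0) / (α₁! α₂!)`. -/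
def taylorCoeff (f : Plane → ℝ) (α : Fin 2 → ℕ) : ℝ :=
  ((partialDeriv 0)^[α 0] ((partialDeriv 1)^[α 1] f)) 0 /
    (((α 0).factorial : ℝ) * ((α 1).factorial : ℝ))

/-- The Taylor support of `f` at the origin. -/
def taylorSupport (f : Plane → ℝ) : Set (Fin 2 → ℕ) :=
  {α | α ≠ 0 ∧ taylorCoeff f α ≠ 0}

/-- The Newton polyhedron: the convex hull of the union of the octants `α + ℝ₊²`, where `α` runs
through the Taylor support. -/
def newtonPolyhedron (f : Plane → ℝ) : Set Plane :=
  convexHull ℝ (⋃ α ∈ taylorSupport f, {t : Plane | ∀ i, (α i : ℝ) ≤ t i})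

/-- The Newton distance: the coordinate `d` of the point `(d, d)` at which the bisectrix enters
the Newton polyhedron. It is `⊤` if the polyhedron is empty, that is, if `f - f 0` is flat. -/
def newtonDistance (f : Plane → ℝ) : EReal :=
  ⨅ d ∈ {d : ℝ | (!₂[d, d] : Plane) ∈ newtonPolyhedron f}, (d : EReal)

/-- The linear height: the supremum of the Newton distances of `f` in all linear coordinate
systems. -/
def linearHeight (f : Plane → ℝ) : EReal :=
  ⨆ T : Plane ≃L[ℝ] Plane, newtonDistance (f ∘ T)

/-! ### Symbols and convolution operators -/

/-- `Γ` is an open conic neighbourhood of `v`. -/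
def IsConicNhd (Γ : Set Space) (v : Space) : Prop :=
  IsOpen Γ ∧ v ∈ Γ ∧ ∀ ξ ∈ Γ, ∀ t : ℝ, 0 < t → t • ξ ∈ Γ

/-- Classical (polyhomogeneous) symbols of order `m` with constant coefficients: smooth functions
`a` with an asymptotic expansion `a ~ ∑ⱼ bⱼ` for large `ξ`, where `bⱼ` is smooth away from the
origin and positively homogeneous of degree `m - j`. -/
def IsClassicalSymbol (m : ℝ) (a : Space → ℂ) : Prop :=
  ContDiff ℝ ∞ a ∧
  ∃ b : ℕ → Space → ℂ,
    (∀ j, ContDiffOn ℝ ∞ (b j) {0}ᶜ) ∧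
    (∀ j, ∀ ξ : Space, ξ ≠ 0 → ∀ t : ℝ, 0 < t →
      b j (t • ξ) = ((t ^ (m - (j : ℝ)) : ℝ) : ℂ) * b j ξ) ∧
    ∀ N n : ℕ, ∃ C : ℝ, ∀ ξ : Space, 1 ≤ ‖ξ‖ →
      ‖iteratedFDeriv ℝ n (fun η => a η - ∑ j ∈ Finset.range N, b j η) ξ‖
        ≤ C * ‖ξ‖ ^ (m - (N : ℝ) - (n : ℝ))

/-- The space of classical symbols of order `m` with support in `Γ`. -/
def classicalSymbolsIn (m : ℝ) (Γ : Set Space) : Set (Space → ℂ) :=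
  {a | IsClassicalSymbol m a ∧ tsupport a ⊆ Γ}

/-- The Fourier transform `(2π)^(-3/2) ∫ e^{i ξ·x} u(x) dx`. -/
def fourierOp (u : Space → ℂ) (ξ : Space) : ℂ :=
  ((Real.sqrt ((2 * Real.pi) ^ 3))⁻¹ : ℝ) *
    ∫ x : Space, Complex.exp (Complex.I * (inner ℝ ξ x : ℝ)) * u x

/-- The inverse Fourier transform `(2π)^(-3/2) ∫ e^{-i ξ·x} w(ξ) dξ`. -/
def fourierOpInv (w : Space → ℂ) (x : Space) : ℂ :=
  ((Real.sqrt ((2 * Real.pi) ^ 3))⁻¹ : ℝ) *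
    ∫ ξ : Space, Complex.exp (-(Complex.I * (inner ℝ ξ x : ℝ))) * w ξ

/-- The operator `M = F⁻¹ [e^{iφ} a] F`. -/
def convOp (φ : Space → ℝ) (a : Space → ℂ) (u : Space → ℂ) : Space → ℂ :=
  fourierOpInv fun ξ => Complex.exp (Complex.I * (φ ξ : ℂ)) * a ξ * fourierOp u ξ

/-- `F⁻¹ [e^{iφ} a] F`, defined on Schwartz functions, is bounded from `L^p` to `L^{p'}`, where
`1/p + 1/p' = 1`. -/
def ConvOpBounded (φ : Space → ℝ) (a : Space → ℂ) (p : ℝ≥0∞) : Prop :=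
  ∃ C : ℝ≥0, ∀ u : SchwartzMap Space ℂ,
    eLpNorm (convOp φ a u) p.conjExponent volume ≤ C * eLpNorm u p volume

/-- The local critical exponent `k_p(v)`: the infimum of all `k > 0` for which there is an open
conic neighbourhood `Γ` of `v`, on which `φ` is smooth, such that `F⁻¹ [e^{iφ} a] F` is bounded
from `L^p` to `L^{p'}` for every classical symbol `a` of order `-k` with support in `Γ`. -/
def criticalExponent (φ : Space → ℝ) (v : Space) (p : ℝ) : EReal :=
  ⨅ k ∈ {k : ℝ | 0 < k ∧ ∃ Γ : Set Space, IsConicNhd Γ v ∧ ContDiffOn ℝ ∞ φ Γ ∧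
    ∀ a ∈ classicalSymbolsIn (-k) Γ, ConvOpBounded φ a (ENNReal.ofReal p)}, (k : EReal)

end

/-! ### Supporting lines of the Newton polyhedron -/

/-! The bound is a Knapp example. Fix linear coordinates `T` and `0 < d < newtonDistance (ϕ ∘ T)`. A
line separating `(d, d)` from the Newton polyhedron gives weights `κ 0, κ 1 > 0` with sum `1 / d`
such that every exponent in the Taylor support has weighted degree at least `1`. Hence `|ϕ ∘ T| ≤ ε
/ lam` on the box `|x i| ≤ r * lam ^ (-κ i)` (`exists_box_abs_le`). Homogeneity turns the graph
equation into `φ ξ - ξ 2 = -φ ξ * ϕ (ξ' / φ ξ)`, where `ξ'` is the pair of the first two coordinates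
(`sub_eq_neg_mul_of_graph`). So `φ` differs from the linear function `⟪ξ, v⟫` by at most `1 / 2` on
a box `R` around `lam • v`, with sides of order `lam ^ (1 - κ 0)`, `lam ^ (1 - κ 1)`, `lam` and
volume `|R| ~ lam ^ (3 - 1 / d)`. There `exp (iφ)` acts essentially as a translation by `v`. Let `u`
have as Fourier transform a bump on `R` times `exp (-i⟪ξ, v⟫)`. Then `‖u‖_p ~ |R| ^ (1 - 1 / p)`,
while for a symbol `a ≥ 0` elliptic near `v` the image has size at least `lam ^ (-k) * |R|`, up to a
constant, on a set dual to `R`, of volume `~ 1 / |R|`. Boundedness forces `lam ^ (-k) * |R| ^ (2 / p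
- 1) ≤ C` (`exists_knapp_bound`), and `lam → ∞` gives `(3 - 1 / d) * (2 / p - 1) ≤ k`. Finally `d`
increases to the linear height. -/

theorem newtonPolyhedron_le_sum {f : Plane → ℝ} {t : Plane} (ht : t ∈ newtonPolyhedron f) :
    1 ≤ t 0 + t 1 := by
  have hconv : Convex ℝ {t : Plane | 1 ≤ t 0 + t 1} := by
    intro x hx y hy a b ha hb hab
    simp only [Set.mem_ofPred_eq, PiLp.add_apply, PiLp.smul_apply, smul_eq_mul] at *
    nlinarith
  refine convexHull_min ?_ hconv ht
  simp only [Set.iUnion_subset_iff]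
  intro α hα t ht
  have h0 := ht 0
  have h1 := ht 1
  have : 1 ≤ α 0 + α 1 := by
    by_contra h
    apply hα.1
    funext i
    fin_cases i <;> simp <;> omega
  have : (1 : ℝ) ≤ α 0 + α 1 := by exact_mod_cast this
  simp only [Set.mem_ofPred_eq]
  linarith

/-- A crude bound: it only serves to make the linear height positive, so that the approximating `d`
can be taken positive. -/
theorem half_le_newtonDistance (f : Plane → ℝ) : ((1 / 2 : ℝ) : EReal) ≤ newtonDistance f := by
  refine le_iInf₂ fun d hd => ?_
  have := newtonPolyhedron_le_sum hd
  simp at this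
  exact_mod_cast (by linarith : (1 / 2 : ℝ) ≤ d)

theorem diag_notMem_newtonPolyhedron {f : Plane → ℝ} {d : ℝ}
    (hd : (d : EReal) < newtonDistance f) : (!₂[d, d] : Plane) ∉ newtonPolyhedron f :=
  fun h => absurd (iInf₂_le (f := fun (d : ℝ) _ => (d : EReal)) d h) (not_le.2 hd)

/-- Hahn–Banach separates `(d, d)` from the interior of the polyhedron; the normal of the separating
line, normalised to sum one, gives the weights. -/
theorem exists_nonneg_weights {f : Plane → ℝ} {d : ℝ} (hd : (d : EReal) < newtonDistance f) :
    ∃ κ : Fin 2 → ℝ, (∀ i, 0 ≤ κ i) ∧ κ 0 + κ 1 = 1 ∧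
      ∀ α ∈ taylorSupport f, d ≤ κ 0 * α 0 + κ 1 * α 1 := by
  rcases (taylorSupport f).eq_empty_or_nonempty with he | ⟨α₀, hα₀⟩
  · exact ⟨fun _ => 1 / 2, fun _ => by norm_num, by norm_num, by simp [he]⟩
  have hx := diag_notMem_newtonPolyhedron hd
  have hconv : Convex ℝ (newtonPolyhedron f) := convex_convexHull _ _
  obtain ⟨l, hl⟩ := geometric_hahn_banach_open_point hconv.interior isOpen_interior
    (fun h => hx (interior_subset h))
  set w : Fin 2 → ℝ := fun i => -l (EuclideanSpace.single i 1) with hw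
  have hlt (t : Plane) : l t = -(w 0 * t 0 + w 1 * t 1) := by
    have : t = t 0 • EuclideanSpace.single 0 (1 : ℝ) + t 1 • EuclideanSpace.single 1 (1 : ℝ) := by
      ext i; fin_cases i <;> simp
    conv_lhs => rw [this]
    simp only [map_add, map_smul, smul_eq_mul, hw]
    ring
  have hint (α) (hα : α ∈ taylorSupport f) (s t : ℝ) (hs : 0 < s) (ht : 0 < t) :
      (w 0 + w 1) * d < w 0 * (α 0 + s) + w 1 * (α 1 + t) := by
    have hmem : (!₂[α 0 + s, α 1 + t] : Plane) ∈ interior (newtonPolyhedron f) := by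
      rw [mem_interior]
      refine ⟨{t : Plane | ∀ i, (α i : ℝ) < t i}, ?_, ?_, ?_⟩
      · intro t ht
        exact subset_convexHull _ _ (Set.mem_biUnion hα fun i => (ht i).le)
      · simp only [Set.ofPred_forall]
        exact isOpen_iInter_of_finite fun i => isOpen_lt continuous_const (by fun_prop)
      · intro i
        fin_cases i <;> simp <;> assumption
    have := hl _ hmem
    rw [hlt, hlt] at this
    simp at this
    linarith
  -- Corners `α` need not be interior points, so they are approached from inside their octant.
  have hlim (α) (hα : α ∈ taylorSupport f) :
      (w 0 + w 1) * d ≤ w 0 * α 0 + w 1 * α 1 := by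
    refine ge_of_tendsto (x := nhdsWithin (0 : ℝ) (Set.Ioi 0))
      (f := fun s => w 0 * (α 0 + s) + w 1 * (α 1 + s)) ?_ ?_
    · have : Continuous fun s : ℝ => w 0 * (α 0 + s) + w 1 * (α 1 + s) := by fun_prop
      simpa using (this.tendsto 0).mono_left nhdsWithin_le_nhds
    · filter_upwards [self_mem_nhdsWithin] with s hs using (hint α hα s s hs hs).le
  -- The octant at `α₀` is unbounded in each coordinate direction, which excludes a negative weight.
  have hw0 : 0 ≤ w 0 := by
    by_contra! h
    obtain ⟨n, hn⟩ := exists_nat_gt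
      ((w 0 * α₀ 0 + w 1 * (α₀ 1 + 1) - (w 0 + w 1) * d) / (-w 0))
    rw [div_lt_iff₀ (by linarith)] at hn
    have := hint α₀ hα₀ (n + 1) 1 (by positivity) one_pos
    nlinarith
  have hw1 : 0 ≤ w 1 := by
    by_contra! h
    obtain ⟨n, hn⟩ := exists_nat_gt
      ((w 0 * (α₀ 0 + 1) + w 1 * α₀ 1 - (w 0 + w 1) * d) / (-w 1))
    rw [div_lt_iff₀ (by linarith)] at hn
    have := hint α₀ hα₀ 1 (n + 1) one_pos (by positivity)
    nlinarith
  have hpos : 0 < w 0 + w 1 := by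
    by_contra! h
    have h0 : w 0 = 0 := by linarith
    have h1 : w 1 = 0 := by linarith
    have := hint α₀ hα₀ 1 1 one_pos one_pos
    simp [h0, h1] at this
  refine ⟨fun i => w i / (w 0 + w 1), fun i => ?_, ?_, fun α hα => ?_⟩
  · fin_cases i
    · exact div_nonneg hw0 hpos.le
    · exact div_nonneg hw1 hpos.le
  · rw [← add_div, div_self hpos.ne']
  · have := hlim α hα
    rw [div_mul_eq_mul_div, div_mul_eq_mul_div, ← add_div, le_div_iff₀ hpos]
    linarith

/-- A separating line may be parallel to an axis. The gap between `d` and some larger `e`, still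
below the Newton distance, pays for raising both weights: adding `(e / d - 1) / 2` to each turns the
sum `1` into `e / d`, and division by `e` leaves `1 / d`. -/
theorem exists_pos_weights {f : Plane → ℝ} {d : ℝ} (hd0 : 0 < d)
    (hd : (d : EReal) < newtonDistance f) :
    ∃ κ : Fin 2 → ℝ, (∀ i, 0 < κ i) ∧ κ 0 + κ 1 = 1 / d ∧
      ∀ α ∈ taylorSupport f, 1 ≤ κ 0 * α 0 + κ 1 * α 1 := by
  obtain ⟨e, hde, hef⟩ := EReal.lt_iff_exists_real_btwn.1 hd
  have hde : d < e := by exact_mod_cast hde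
  have he : 0 < e := hd0.trans hde
  obtain ⟨κ, hκ, hsum, hα⟩ := exists_nonneg_weights hef
  refine ⟨fun i => (κ i + (e / d - 1) / 2) / e, fun i => ?_, ?_, fun α h => ?_⟩
  · have : 1 < e / d := (one_lt_div hd0).2 hde
    have := hκ i
    exact div_pos (by linarith) he
  · rw [← add_div, show κ 0 + (e / d - 1) / 2 + (κ 1 + (e / d - 1) / 2) = e / d by linarith]
    field_simp
  · have h1 : 0 < e / d - 1 := sub_pos.2 ((one_lt_div hd0).2 hde)
    have := hα α h
    rw [div_mul_eq_mul_div, div_mul_eq_mul_div, ← add_div, one_le_div he]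
    have h2 : 0 ≤ (e / d - 1) / 2 * (α 0 : ℝ) := by positivity
    have h3 : 0 ≤ (e / d - 1) / 2 * (α 1 : ℝ) := by positivity
    linarith

/-! ### Anisotropic Taylor estimate -/

theorem ContDiffAt.partialDeriv {f : Plane → ℝ} {x : Plane} (hf : ContDiffAt ℝ ∞ f x) (i : Fin 2) :
    ContDiffAt ℝ ∞ (partialDeriv i f) x :=
  (hf.fderiv_right (m := ∞) (by simp)).clm_apply contDiffAt_const

theorem abs_sub_le_of_partialDeriv_le {f : Plane → ℝ} (i : Fin 2) (y : Plane) (s C : ℝ)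
    (hd : ∀ τ ∈ Set.Icc (0 : ℝ) 1,
      DifferentiableAt ℝ f (y + (τ * s) • EuclideanSpace.single i (1 : ℝ)))
    (hb : ∀ τ ∈ Set.Icc (0 : ℝ) 1,
      |partialDeriv i f (y + (τ * s) • EuclideanSpace.single i (1 : ℝ))| ≤ C) :
    |f (y + s • EuclideanSpace.single i (1 : ℝ)) - f y| ≤ C * |s| := by
  set e : Plane := EuclideanSpace.single i (1 : ℝ)
  have key := norm_image_sub_le_of_norm_deriv_le_segment_01'
    (f := fun τ : ℝ => f (y + (τ * s) • e)) (f' := fun τ => s * partialDeriv i f (y + (τ * s) • e))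
    (C := C * |s|) (fun τ hτ => ?_) (fun τ hτ => ?_)
  · simpa using key
  · have h1 : HasDerivAt (fun τ : ℝ => y + (τ * s) • e) (s • e) τ := by
      have := (((hasDerivAt_id τ).mul_const s).smul_const e).const_add y
      simpa using this
    have h2 := (hd τ hτ).hasFDerivAt.comp_hasDerivAt τ h1
    have h3 : (fderiv ℝ f (y + (τ * s) • e)) (s • e)
        = s * partialDeriv i f (y + (τ * s) • e) := by
      rw [map_smul]; rfl
    rw [h3] at h2
    exact h2.hasDerivWithinAt
  · rw [norm_mul, mul_comm]
    exact mul_le_mul_of_nonneg_right (hb τ ⟨hτ.1, hτ.2.le⟩) (norm_nonneg _)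

/-- The point of the plane with the given coordinates. -/
noncomputable abbrev planePoint (s t : ℝ) : Plane :=
  s • EuclideanSpace.single 0 (1 : ℝ) + t • EuclideanSpace.single 1 (1 : ℝ)

theorem exists_nhd_contDiffAt_bound {f : Plane → ℝ} (hf : ContDiffAt ℝ ∞ f 0) :
    ∃ r > 0, ∃ C, 0 ≤ C ∧ ∀ s t : ℝ, |s| ≤ r → |t| ≤ r →
      DifferentiableAt ℝ f (planePoint s t) ∧ |f (planePoint s t)| ≤ C := by
  have h1 : ∀ᶠ x in nhds (0 : Plane), DifferentiableAt ℝ f x := by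
    filter_upwards [(hf.of_le (m := 1) (by exact_mod_cast le_top)).eventually (by simp)]
      with x hx using hx.differentiableAt (by simp)
  have h2 : ∀ᶠ x in nhds (0 : Plane), |f x| < |f 0| + 1 :=
    hf.continuousAt.abs.eventually_lt continuousAt_const (by simp)
  obtain ⟨δ, hδ, h⟩ := Metric.eventually_nhds_iff.1 (h1.and h2)
  refine ⟨δ / 3, by positivity, |f 0| + 1, by positivity, fun s t hs ht => ?_⟩
  have := h (y := planePoint s t) (by
    rw [dist_zero_right]
    refine (norm_add_le _ _).trans_lt ?_
    simp only [norm_smul, PiLp.norm_single, Real.norm_eq_abs, abs_one, mul_one]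
    linarith)
  exact ⟨this.1, this.2.le⟩

theorem abs_mul_le_of_mem_Icc {τ s R : ℝ} (hτ : τ ∈ Set.Icc (0 : ℝ) 1) (hs : |s| ≤ R) :
    |τ * s| ≤ R := by
  rw [abs_mul, abs_of_nonneg hτ.1]
  nlinarith [abs_nonneg s, hτ.2]

/-- The conclusion of the anisotropic Taylor estimate along the first axis. -/
def AxisBound (κ m : ℝ) (f : Plane → ℝ) : Prop :=
  ∃ r > 0, ∃ C, 0 ≤ C ∧ ∀ ρ : ℝ, 0 < ρ → ρ ≤ 1 → ∀ s, |s| ≤ r * ρ ^ κ →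
    |f (planePoint s 0)| ≤ C * ρ ^ m

/-- The conclusion of the anisotropic Taylor estimate on boxes. -/
def BoxBound (κ : Fin 2 → ℝ) (m : ℝ) (f : Plane → ℝ) : Prop :=
  ∃ r > 0, ∃ C, 0 ≤ C ∧ ∀ ρ : ℝ, 0 < ρ → ρ ≤ 1 → ∀ s t, |s| ≤ r * ρ ^ κ 0 → |t| ≤ r * ρ ^ κ 1 →
    |f (planePoint s t)| ≤ C * ρ ^ m

/-- Base case of the inductions below: for `m ≤ 0` one has `ρ ^ m ≥ 1`, so local boundedness
suffices. -/
theorem boxBound_of_nonpos {κ : Fin 2 → ℝ} (hκ : ∀ i, 0 < κ i) {m : ℝ} (hm : m ≤ 0)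
    {f : Plane → ℝ} (hf : ContDiffAt ℝ ∞ f 0) : BoxBound κ m f := by
  obtain ⟨r, hr, C, hC, h⟩ := exists_nhd_contDiffAt_bound hf
  refine ⟨r, hr, C, hC, fun ρ h0 h1 s t hs ht => ?_⟩
  have hle (i) : r * ρ ^ κ i ≤ r :=
    mul_le_of_le_one_right hr.le (Real.rpow_le_one h0.le h1 (hκ i).le)
  refine (h s t (hs.trans (hle 0)) (ht.trans (hle 1))).2.trans ?_
  exact le_mul_of_one_le_right hC (Real.one_le_rpow_of_pos_of_le_one_of_nonpos h0 h1 hm)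

theorem BoxBound.axisBound {κ : Fin 2 → ℝ} {m : ℝ} {f : Plane → ℝ} (h : BoxBound κ m f) :
    AxisBound (κ 0) m f := by
  obtain ⟨r, hr, C, hC, h⟩ := h
  refine ⟨r, hr, C, hC, fun ρ h0 h1 s hs => h ρ h0 h1 s 0 hs ?_⟩
  simp only [abs_zero]
  positivity

/-- Each derivative lowers the required order by `κ`, and integrating it back over a length `~ ρ ^
κ` regains it. After `n` derivatives the order is nonpositive. -/
theorem axisBound_of_iterate_eq_zero {κ : ℝ} (hκ : 0 < κ) (n : ℕ) : ∀ (m : ℝ) (f : Plane → ℝ),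
    m ≤ n * κ → ContDiffAt ℝ ∞ f 0 →
    (∀ a : ℕ, κ * a < m → (partialDeriv 0)^[a] f 0 = 0) → AxisBound κ m f := by
  induction n with
  | zero =>
    intro m f hm hf _
    exact (boxBound_of_nonpos (κ := fun _ => κ) (fun _ => hκ) (by simpa using hm) hf).axisBound
  | succ n ih =>
    intro m f hm hf h
    rcases le_or_gt m 0 with hm0 | hm0
    · exact (boxBound_of_nonpos (κ := fun _ => κ) (fun _ => hκ) hm0 hf).axisBound
    obtain ⟨r, hr, C, hC, hb⟩ := ih (m - κ) (partialDeriv 0 f)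
      (by push_cast at hm; linarith) (hf.partialDeriv 0) (fun a ha => by
        have := h (a + 1) (by push_cast; linarith)
        rwa [Function.iterate_succ_apply] at this)
    obtain ⟨r', hr', _, _, hd⟩ := exists_nhd_contDiffAt_bound hf
    refine ⟨min r r', lt_min hr hr', C * r, by positivity, fun ρ h0 h1 s hs => ?_⟩
    have hρ : 0 < ρ ^ κ := Real.rpow_pos_of_pos h0 _
    have hρ1 : ρ ^ κ ≤ 1 := Real.rpow_le_one h0.le h1 hκ.le
    have hs1 : |s| ≤ r * ρ ^ κ :=
      hs.trans (mul_le_mul_of_nonneg_right (min_le_left _ _) hρ.le)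
    have hs2 : |s| ≤ r' := hs.trans
      ((mul_le_mul_of_nonneg_right (min_le_right _ _) hρ.le).trans
        (mul_le_of_le_one_right hr'.le hρ1))
    have key := abs_sub_le_of_partialDeriv_le (f := f) 0 0 s (C * ρ ^ (m - κ))
      (fun τ hτ => by
        simpa [planePoint] using (hd (τ * s) 0 (abs_mul_le_of_mem_Icc hτ hs2) (by simpa using hr'.le)).1)
      (fun τ hτ => by
        simpa [planePoint] using hb ρ h0 h1 (τ * s) (abs_mul_le_of_mem_Icc hτ hs1))
    have hf0 : f 0 = 0 := h 0 (by simpa using hm0)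
    rw [hf0, sub_zero, zero_add] at key
    simp only [planePoint, zero_smul, add_zero]
    calc _ ≤ _ := key
      _ ≤ C * ρ ^ (m - κ) * (r * ρ ^ κ) := by gcongr
      _ = C * r * (ρ ^ (m - κ) * ρ ^ κ) := by ring
      _ = _ := by rw [← Real.rpow_add h0, sub_add_cancel]

/-- Integrate `∂₁ f` in the second variable, starting from the first axis, where
`axisBound_of_iterate_eq_zero` applies. As `∂₁` is innermost in the iterated derivatives, removing
it first avoids commuting partial derivatives. -/
theorem boxBound_of_iterate_eq_zero {κ : Fin 2 → ℝ} (hκ : ∀ i, 0 < κ i) (n : ℕ) :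
    ∀ (m : ℝ) (f : Plane → ℝ), m ≤ n * κ 1 → ContDiffAt ℝ ∞ f 0 →
    (∀ a b : ℕ, κ 0 * a + κ 1 * b < m →
      (partialDeriv 0)^[a] ((partialDeriv 1)^[b] f) 0 = 0) → BoxBound κ m f := by
  induction n with
  | zero =>
    intro m f hm hf _
    exact boxBound_of_nonpos hκ (by simpa using hm) hf
  | succ n ih =>
    intro m f hm hf h
    obtain ⟨r, hr, C, hC, hb⟩ := ih (m - κ 1) (partialDeriv 1 f)
      (by push_cast at hm; linarith) (hf.partialDeriv 1) (fun a b hab => by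
        have := h a (b + 1) (by push_cast; linarith)
        rwa [Function.iterate_succ_apply] at this)
    obtain ⟨N, hN⟩ := exists_nat_ge (m / κ 0)
    obtain ⟨r₁, hr₁, C₁, hC₁, hb₁⟩ := axisBound_of_iterate_eq_zero (hκ 0) N m f
      ((div_le_iff₀ (hκ 0)).1 hN) hf (fun a ha => by simpa using h a 0 (by simpa using ha))
    obtain ⟨r₂, hr₂, _, _, hd⟩ := exists_nhd_contDiffAt_bound hf
    refine ⟨min r (min r₁ r₂), lt_min hr (lt_min hr₁ hr₂), C * r + C₁, by positivity,
      fun ρ h0 h1 s t hs ht => ?_⟩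
    have hρ (i) : 0 < ρ ^ κ i := Real.rpow_pos_of_pos h0 _
    have hρ1 (i) : ρ ^ κ i ≤ 1 := Real.rpow_le_one h0.le h1 (hκ i).le
    have hle {x : ℝ} (i) (r' : ℝ) (hr' : min r (min r₁ r₂) ≤ r')
        (hx : |x| ≤ min r (min r₁ r₂) * ρ ^ κ i) : |x| ≤ r' * ρ ^ κ i :=
      hx.trans (mul_le_mul_of_nonneg_right hr' (hρ i).le)
    have hle2 {x : ℝ} (i) (hx : |x| ≤ min r (min r₁ r₂) * ρ ^ κ i) : |x| ≤ r₂ :=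
      (hle i r₂ (by simp) hx).trans (mul_le_of_le_one_right hr₂.le (hρ1 i))
    have key := abs_sub_le_of_partialDeriv_le (f := f) 1
      (s • EuclideanSpace.single 0 (1 : ℝ)) t (C * ρ ^ (m - κ 1))
      (fun τ hτ => (hd s (τ * t) (hle2 0 hs) (abs_mul_le_of_mem_Icc hτ (hle2 1 ht))).1)
      (fun τ hτ => hb ρ h0 h1 s (τ * t) (hle 0 r (by simp) hs)
        (abs_mul_le_of_mem_Icc hτ (hle 1 r (by simp) ht)))
    have key1 := hb₁ ρ h0 h1 s (hle 0 r₁ (by simp) hs)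
    simp only [planePoint, zero_smul, add_zero] at key1
    have htr := hle 1 r (by simp) ht
    have key2 : C * ρ ^ (m - κ 1) * |t| ≤ C * r * ρ ^ m := by
      calc _ ≤ C * ρ ^ (m - κ 1) * (r * ρ ^ κ 1) := by gcongr
        _ = C * r * (ρ ^ (m - κ 1) * ρ ^ κ 1) := by ring
        _ = _ := by rw [← Real.rpow_add h0, sub_add_cancel]
    calc |f (planePoint s t)|
        = |(f (planePoint s t) - f (s • EuclideanSpace.single 0 (1 : ℝ)))
            + f (s • EuclideanSpace.single 0 (1 : ℝ))| := by rw [sub_add_cancel]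
      _ ≤ _ := abs_add_le _ _
      _ ≤ C * r * ρ ^ m + C₁ * ρ ^ m := add_le_add (key.trans key2) key1
      _ = _ := by ring

/-- Below the Newton distance there is an anisotropic box, of area `lam ^ (-1 / d)` up to a factor,
on which the function is at most `ε / lam`. -/
theorem exists_box_abs_le {f : Plane → ℝ} (hf : ContDiffAt ℝ ∞ f 0) (hf0 : f 0 = 0) {d : ℝ}
    (hd0 : 0 < d) (hd : (d : EReal) < newtonDistance f) {ε : ℝ} (hε : 0 < ε) :
    ∃ κ : Fin 2 → ℝ, (∀ i, 0 < κ i) ∧ κ 0 + κ 1 = 1 / d ∧ ∃ r > 0, ∀ lam : ℝ, 1 ≤ lam →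
      ∀ x : Plane, (∀ i, |x i| ≤ r * lam ^ (-κ i)) → |f x| ≤ ε / lam := by
  obtain ⟨κ, hκ, hsum, hα⟩ := exists_pos_weights hd0 hd
  refine ⟨κ, hκ, hsum, ?_⟩
  obtain ⟨N, hN⟩ := exists_nat_ge (1 / κ 1)
  obtain ⟨r, hr, C, hC, hb⟩ := boxBound_of_iterate_eq_zero hκ N 1 f
    ((div_le_iff₀ (hκ 1)).1 hN) hf (fun a b hab => by
      by_contra hne
      by_cases h0 : a = 0 ∧ b = 0
      · obtain ⟨rfl, rfl⟩ := h0
        exact hne hf0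
      have := hα ![a, b] ⟨fun h => h0 ⟨by simpa using congrFun h 0, by simpa using congrFun h 1⟩, by
        simp only [taylorCoeff, Matrix.cons_val_zero, Matrix.cons_val_one]
        exact div_ne_zero hne (by positivity)⟩
      simp at this
      linarith)
  -- Taking `ρ = (A * lam)⁻¹` absorbs the Taylor constant, since `C / A ≤ ε`; the price is a smaller
  -- radius.
  set A : ℝ := max 1 (C / ε) with hA
  have hA1 : 1 ≤ A := le_max_left _ _
  have hA0 : 0 < A := one_pos.trans_le hA1
  refine ⟨r * min (A ^ (-κ 0)) (A ^ (-κ 1)), by positivity, fun lam hlam x hx => ?_⟩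
  have hlam0 : 0 < lam := one_pos.trans_le hlam
  have hxi (i) : |x i| ≤ r * ((A * lam)⁻¹) ^ κ i := by
    refine (hx i).trans ?_
    rw [Real.inv_rpow (by positivity), ← Real.rpow_neg (by positivity),
      Real.mul_rpow hA0.le hlam0.le, ← mul_assoc]
    gcongr
    fin_cases i
    · exact min_le_left _ _
    · exact min_le_right _ _
  have hpt : planePoint (x 0) (x 1) = x := by
    ext i; fin_cases i <;> simp
  have := hb (A * lam)⁻¹ (by positivity) (inv_le_one_of_one_le₀ (one_le_mul_of_one_le_of_one_le hA1 hlam))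
    (x 0) (x 1) (hxi 0) (hxi 1)
  rw [hpt, Real.rpow_one] at this
  refine this.trans ?_
  rw [mul_inv, ← mul_assoc, div_eq_mul_inv]
  gcongr
  rw [← div_eq_mul_inv, div_le_iff₀ hA0, mul_comm, ← div_le_iff₀ hε]
  exact le_max_right _ _

/-! ### Homogeneous symbols -/

/-- `b` is positively homogeneous of degree `m` off the origin. -/
def IsHomogeneousOfDegree (m : ℝ) (b : Space → ℂ) : Prop :=
  ∀ ξ : Space, ξ ≠ 0 → ∀ t : ℝ, 0 < t → b (t • ξ) = ((t ^ m : ℝ) : ℂ) * b ξ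

/-- With `‖ξ‖` frozen, `b η = ‖ξ‖ ^ m * b (‖ξ‖⁻¹ • η)` for `η` near `ξ`. Each derivative brings a
factor `‖ξ‖⁻¹`, and what remains is bounded on the compact unit sphere. -/
theorem IsHomogeneousOfDegree.exists_norm_iteratedFDeriv_le {m : ℝ} {b : Space → ℂ}
    (hom : IsHomogeneousOfDegree m b) (hb : ContDiffOn ℝ ∞ b {0}ᶜ) (n : ℕ) :
    ∃ C : ℝ, ∀ ξ : Space, ξ ≠ 0 → ‖iteratedFDeriv ℝ n b ξ‖ ≤ C * ‖ξ‖ ^ (m - n) := by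
  have hat (ξ : Space) (hξ : ξ ≠ 0) : ContDiffAt ℝ ∞ b ξ :=
    hb.contDiffAt (isOpen_compl_singleton.mem_nhds hξ)
  have hcont : ContinuousOn (iteratedFDeriv ℝ n b) (Metric.sphere 0 1) := by
    intro ξ hξ
    have hξ0 : ξ ≠ 0 := by
      rintro rfl
      simp at hξ
    exact ((hat ξ hξ0).iteratedFDeriv_right (m := 0) (i := n)
      (by simp only [zero_add]; exact_mod_cast le_top)).continuousAt.continuousWithinAt
  obtain ⟨C, hC⟩ := (isCompact_sphere (0 : Space) 1).exists_bound_of_continuousOn hcont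
  refine ⟨C, fun ξ hξ => ?_⟩
  have ht : 0 < ‖ξ‖ := norm_pos_iff.2 hξ
  set g : Space ≃L[ℝ] Space := ContinuousLinearEquiv.smulLeft (Units.mk0 (‖ξ‖⁻¹) (by positivity))
    with hg
  have hgx (η : Space) : g η = ‖ξ‖⁻¹ • η := rfl
  have hgn : ‖(g : Space →L[ℝ] Space)‖ ≤ ‖ξ‖⁻¹ := by
    refine ContinuousLinearMap.opNorm_le_bound _ (by positivity) fun η => ?_
    change ‖g η‖ ≤ _
    rw [hgx, norm_smul, norm_inv, norm_norm]
  have heq : b =ᶠ[nhds ξ] fun η => (‖ξ‖ ^ m : ℝ) • (b ∘ g) η := by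
    filter_upwards [isOpen_compl_singleton.mem_nhds hξ] with η hη
    have := hom (g η) (by simpa using hη) ‖ξ‖ ht
    rw [hgx, smul_inv_smul₀ ht.ne'] at this
    rw [this, Complex.real_smul]
    rfl
  have hgξ : g ξ ∈ Metric.sphere (0 : Space) 1 := by
    rw [mem_sphere_zero_iff_norm, hgx, norm_smul, norm_inv, norm_norm, inv_mul_cancel₀ ht.ne']
  have hD : iteratedFDeriv ℝ n (b ∘ g) ξ
      = (iteratedFDeriv ℝ n b (g ξ)).compContinuousLinearMap fun _ => (g : Space →L[ℝ] Space) := by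
    have := g.iteratedFDerivWithin_comp_right b (s := Set.univ) uniqueDiffOn_univ
      (x := ξ) (Set.mem_univ _) n
    simpa only [Set.preimage_univ, iteratedFDerivWithin_univ] using this
  have hcd : ContDiffAt ℝ n (b ∘ g) ξ :=
    ((hat (g ξ) (by simpa using hξ)).of_le (by exact_mod_cast le_top)).comp ξ
      g.contDiff.contDiffAt
  rw [(heq.iteratedFDeriv ℝ n).self_of_nhds, iteratedFDeriv_const_smul_apply' hcd, hD, norm_smul,
    Real.norm_of_nonneg (by positivity)]
  calc _ ≤ ‖ξ‖ ^ m * (‖iteratedFDeriv ℝ n b (g ξ)‖ * ∏ _i : Fin n, ‖(g : Space →L[ℝ] Space)‖) := by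
        gcongr
        exact ContinuousMultilinearMap.norm_compContinuousLinearMap_le _ _
    _ ≤ ‖ξ‖ ^ m * (C * ∏ _i : Fin n, ‖ξ‖⁻¹) := by
        have := hC _ hgξ
        have h0 : 0 ≤ C := (norm_nonneg _).trans this
        gcongr
    _ = C * ‖ξ‖ ^ (m - n) := by
        rw [Finset.prod_const, Finset.card_univ, Fintype.card_fin, Real.rpow_sub ht,
          Real.rpow_natCast, inv_pow]
        ring

/-- A smooth function vanishing near the origin and equal to one far from it. -/
noncomputable def originCutoff (ξ : Space) : ℝ :=
  1 - (⟨1 / 4, 1 / 2, by norm_num, by norm_num⟩ : ContDiffBump (0 : Space)) ξ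

theorem contDiff_originCutoff : ContDiff ℝ ∞ originCutoff :=
  contDiff_const.sub (ContDiffBump.contDiff _)

theorem originCutoff_eq_one {ξ : Space} (h : 1 / 2 ≤ ‖ξ‖) : originCutoff ξ = 1 := by
  rw [originCutoff, ContDiffBump.zero_of_le_dist _ (by simpa using h), sub_zero]

theorem originCutoff_eq_zero {ξ : Space} (h : ‖ξ‖ ≤ 1 / 4) : originCutoff ξ = 0 := by
  rw [originCutoff, ContDiffBump.one_of_mem_closedBall _ (by simpa using h), sub_self]

/-- The expansion has the single term `b`. The cutoff is already one for `‖ξ‖ ≥ 1 / 2`, so every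
remainder with `N ≥ 1` vanishes in a neighbourhood of each point with `‖ξ‖ ≥ 1`. -/
theorem isClassicalSymbol_cutoff_mul {m : ℝ} {b : Space → ℂ} (hom : IsHomogeneousOfDegree m b)
    (hb : ContDiffOn ℝ ∞ b {0}ᶜ) :
    IsClassicalSymbol m fun ξ => (originCutoff ξ : ℂ) * b ξ := by
  have heq (ξ : Space) (hξ : 1 ≤ ‖ξ‖) : (fun ξ => (originCutoff ξ : ℂ) * b ξ) =ᶠ[nhds ξ] b := by
    filter_upwards [(isOpen_lt continuous_const continuous_norm).mem_nhds
      (show (1 / 2 : ℝ) < ‖ξ‖ by linarith)] with η hη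
    rw [originCutoff_eq_one (le_of_lt hη), Complex.ofReal_one, one_mul]
  refine ⟨contDiff_iff_contDiffAt.2 fun ξ => ?_, fun j => if j = 0 then b else 0,
    fun j => ?_, fun j ξ hξ t ht => ?_, fun N n => ?_⟩
  · by_cases hξ : ξ = 0
    · have : (fun ξ => (originCutoff ξ : ℂ) * b ξ) =ᶠ[nhds ξ] fun _ => 0 := by
        filter_upwards [Metric.ball_mem_nhds ξ (show (0 : ℝ) < 1 / 4 by norm_num)] with η hη
        rw [hξ, mem_ball_zero_iff] at hη
        rw [originCutoff_eq_zero hη.le, Complex.ofReal_zero, zero_mul]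
      exact contDiffAt_const.congr_of_eventuallyEq this
    · exact (Complex.ofRealCLM.contDiff.comp contDiff_originCutoff).contDiffAt.mul
        (hb.contDiffAt (isOpen_compl_singleton.mem_nhds hξ))
  · beta_reduce
    split_ifs
    · exact hb
    · exact contDiffOn_const
  · beta_reduce
    split_ifs with h
    · simpa [h] using hom ξ hξ t ht
    · simp
  · rcases N with _ | N
    · obtain ⟨C, hC⟩ := hom.exists_norm_iteratedFDeriv_le hb n
      refine ⟨C, fun ξ hξ => ?_⟩
      simp only [Finset.range_zero, Finset.sum_empty, sub_zero, CharP.cast_eq_zero]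
      rw [((heq ξ hξ).iteratedFDeriv ℝ n).self_of_nhds]
      exact hC ξ (norm_pos_iff.1 (one_pos.trans_le hξ))
    · refine ⟨0, fun ξ hξ => ?_⟩
      have : (fun η => (originCutoff η : ℂ) * b η -
          ∑ j ∈ Finset.range (N + 1), (if j = 0 then b else 0 : Space → ℂ) η)
          =ᶠ[nhds ξ] fun _ => 0 := by
        filter_upwards [heq ξ hξ] with η hη
        rw [Finset.sum_range_succ', Finset.sum_eq_zero (by simp)]
        simp only [if_true, zero_add]
        rw [hη, sub_self]
      rw [(this.iteratedFDeriv ℝ n).self_of_nhds, zero_mul, iteratedFDeriv_fun_zero]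
      simp

/-- Every conic neighbourhood of a nonzero vector `v` supports a symbol of a given order that is
real, nonnegative and elliptic near `v`. -/
theorem exists_elliptic_symbol {Γ : Set Space} {v : Space} (hΓ : IsConicNhd Γ v)
    (hv : ‖v‖ = 1) (m : ℝ) :
    ∃ a : Space → ℝ, (fun ξ => (a ξ : ℂ)) ∈ classicalSymbolsIn m Γ ∧ (∀ ξ, 0 ≤ a ξ) ∧
      ∀ᶠ η in nhds v, ∀ t : ℝ, 1 ≤ t → a (t • η) = t ^ m * ‖η‖ ^ m := by
  obtain ⟨ρ, hρ, hball⟩ := Metric.isOpen_iff.1 hΓ.1 v hΓ.2.1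
  set χ : ContDiffBump v := ⟨ρ / 4, ρ / 2, by positivity, by linarith⟩ with hχ
  set b : Space → ℝ := fun ξ => ‖ξ‖ ^ m * χ (‖ξ‖⁻¹ • ξ) with hbdef
  have hbs : ContDiffOn ℝ ∞ b {0}ᶜ := by
    intro ξ hξ
    have hξ : ξ ≠ 0 := hξ
    have h1 : ContDiffAt ℝ ∞ (fun ξ : Space => ‖ξ‖) ξ := contDiffAt_norm ℝ hξ
    have h2 : ‖ξ‖ ≠ 0 := norm_ne_zero_iff.2 hξ
    exact ((h1.rpow_const_of_ne h2).mul
      (χ.contDiff.contDiffAt.comp ξ ((h1.inv h2).smul contDiffAt_id))).contDiffWithinAt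
  have hbh (ξ : Space) (t : ℝ) (ht : 0 < t) : b (t • ξ) = t ^ m * b ξ := by
    simp only [hbdef]
    rw [norm_smul, Real.norm_of_nonneg ht.le, Real.mul_rpow ht.le (norm_nonneg _), smul_smul,
      mul_inv, mul_right_comm t⁻¹, inv_mul_cancel₀ ht.ne', one_mul, mul_assoc]
  refine ⟨fun ξ => originCutoff ξ * b ξ, ⟨?_, ?_⟩, fun ξ => ?_, ?_⟩
  · simp only [Complex.ofReal_mul]
    refine isClassicalSymbol_cutoff_mul (b := fun ξ => (b ξ : ℂ)) (fun ξ _ t ht => ?_)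
      (Complex.ofRealCLM.contDiff.comp_contDiffOn hbs)
    simp only [hbh ξ t ht, Complex.ofReal_mul]
  -- The topological support has to stay in the open cone, hence a closed truncated cone around `v`;
  -- its condition is multiplied through by `‖ξ‖` so that it is visibly closed.
  · have hsub : (tsupport fun ξ => ((originCutoff ξ * b ξ : ℝ) : ℂ)) ⊆
        {ξ : Space | 1 / 4 ≤ ‖ξ‖} ∩ {ξ : Space | ‖ξ - ‖ξ‖ • v‖ ≤ ρ / 2 * ‖ξ‖} := by
      refine closure_minimal ?_ ((isClosed_le continuous_const continuous_norm).inter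
        (isClosed_le (by fun_prop) (by fun_prop)))
      intro ξ hξ
      rw [Function.mem_support, Complex.ofReal_ne_zero] at hξ
      have h1 : 1 / 4 < ‖ξ‖ := by
        by_contra! h
        exact hξ (by rw [originCutoff_eq_zero h, zero_mul])
      have h0 : 0 < ‖ξ‖ := by linarith
      refine ⟨h1.le, ?_⟩
      by_contra h
      simp only [Set.mem_ofPred_eq, not_le] at h
      apply hξ
      simp only [hbdef]
      rw [χ.zero_of_le_dist, mul_zero, mul_zero]
      have : ‖ξ‖⁻¹ • ξ - v = ‖ξ‖⁻¹ • (ξ - ‖ξ‖ • v) := by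
        rw [smul_sub, inv_smul_smul₀ h0.ne']
      rw [dist_eq_norm, this, norm_smul, norm_inv, norm_norm, ← div_eq_inv_mul,
        le_div_iff₀ h0]
      exact h.le
    intro ξ hξ
    obtain ⟨h1, h2⟩ := hsub hξ
    simp only [Set.mem_ofPred_eq] at h1 h2
    have h0 : 0 < ‖ξ‖ := by linarith
    have hmem : ‖ξ‖⁻¹ • ξ ∈ Γ := by
      refine hball ?_
      have : ‖ξ‖⁻¹ • ξ - v = ‖ξ‖⁻¹ • (ξ - ‖ξ‖ • v) := by
        rw [smul_sub, inv_smul_smul₀ h0.ne']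
      rw [Metric.mem_ball, dist_eq_norm, this, norm_smul, norm_inv, norm_norm, ← div_eq_inv_mul,
        div_lt_iff₀ h0]
      nlinarith
    simpa [smul_inv_smul₀ h0.ne'] using hΓ.2.2 _ hmem ‖ξ‖ h0
  · have : 0 ≤ originCutoff ξ := sub_nonneg.2 (ContDiffBump.le_one _)
    exact mul_nonneg this (mul_nonneg (by positivity) (ContDiffBump.nonneg _))
  · have hv0 : v ≠ 0 := by
      rw [← norm_ne_zero_iff, hv]
      exact one_ne_zero
    have hc : ContinuousAt (fun η : Space => ‖η‖⁻¹ • η) v :=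
      (continuousAt_id.norm.inv₀ (norm_ne_zero_iff.2 hv0)).smul continuousAt_id
    have h1 : ∀ᶠ η in nhds v, ‖η‖⁻¹ • η ∈ Metric.ball v (ρ / 4) :=
      hc (Metric.isOpen_ball.mem_nhds (by simpa [hv] using hρ))
    filter_upwards [h1, (isOpen_lt continuous_const continuous_norm).mem_nhds
      (show (1 / 2 : ℝ) < ‖v‖ by rw [hv]; norm_num)] with η hη hη2 t ht
    have ht0 : 0 < t := one_pos.trans_le ht
    rw [originCutoff_eq_one, one_mul, hbh η t ht0]
    · simp only [hbdef]
      rw [χ.one_of_mem_closedBall (Metric.ball_subset_closedBall hη), mul_one]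
    · rw [norm_smul, Real.norm_of_nonneg ht0.le]
      have hη2 : (1 / 2 : ℝ) < ‖η‖ := hη2
      nlinarith

/-! ### Fourier inversion and affine changes of variables -/

/-- The normalising factor `(2π)^(-3/2)` of the Fourier transform. -/
noncomputable def fourierFactor : ℝ := (Real.sqrt ((2 * Real.pi) ^ 3))⁻¹

theorem fourierFactor_pos : 0 < fourierFactor := by
  unfold fourierFactor
  positivity

theorem fourierFactor_mul_self : fourierFactor * fourierFactor = ((2 * Real.pi) ^ 3)⁻¹ := by
  unfold fourierFactor
  rw [← mul_inv, Real.mul_self_sqrt (by positivity)]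

open FourierTransform in
theorem fourierOpInv_eq (w : Space → ℂ) (x : Space) :
    fourierOpInv w x = fourierFactor * 𝓕 w ((2 * Real.pi)⁻¹ • x) := by
  rw [fourierOpInv, Real.fourier_eq']
  congr 1
  refine integral_congr_ae (ae_of_all _ fun ξ => ?_)
  simp only [smul_eq_mul]
  congr 2
  rw [inner_smul_right, show -2 * Real.pi * ((2 * Real.pi)⁻¹ * inner ℝ ξ x) = -inner ℝ ξ x by
    field_simp]
  push_cast
  ring

open FourierTransform in
theorem exists_schwartz_fourierOpInv (w : SchwartzMap Space ℂ) :
    ∃ u : SchwartzMap Space ℂ, (⇑u = fourierOpInv w) ∧ fourierOp u = w := by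
  have h2π : (2 * Real.pi)⁻¹ ≠ 0 := by positivity
  set g : Space ≃L[ℝ] Space := ContinuousLinearEquiv.smulLeft (Units.mk0 _ h2π) with hg
  refine ⟨(fourierFactor : ℂ) • SchwartzMap.compCLMOfContinuousLinearEquiv ℂ g (𝓕 w), ?_, ?_⟩
  · ext x
    rw [fourierOpInv_eq]
    simp only [smul_apply, SchwartzMap.compCLMOfContinuousLinearEquiv_apply,
      Function.comp_apply, smul_eq_mul, SchwartzMap.fourier_coe]
    rfl
  · ext ξ
    have hinv : w ξ = 𝓕⁻ (𝓕 (w : Space → ℂ)) ξ := by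
      rw [← SchwartzMap.fourier_coe, ← SchwartzMap.fourierInv_coe,
        FourierTransform.fourierInv_fourier_eq]
    rw [hinv, Real.fourierInv_eq', fourierOp]
    have hscale := Measure.integral_comp_inv_smul_of_nonneg (volume : Measure Space)
      (fun y : Space => Complex.exp (Complex.I * (inner ℝ ξ ((2 * Real.pi) • y) : ℝ)) *
        ((fourierFactor : ℂ) * 𝓕 (w : Space → ℂ) y)) (R := 2 * Real.pi) (by positivity)
    have hl : (fun x : Space => Complex.exp (Complex.I * (inner ℝ ξ x : ℝ)) *
        ((fourierFactor : ℂ) • SchwartzMap.compCLMOfContinuousLinearEquiv ℂ g (𝓕 w)) x) =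
        fun x => Complex.exp (Complex.I *
          (inner ℝ ξ ((2 * Real.pi) • (2 * Real.pi)⁻¹ • x) : ℝ)) *
          ((fourierFactor : ℂ) * 𝓕 (w : Space → ℂ) ((2 * Real.pi)⁻¹ • x)) := by
      funext x
      rw [smul_inv_smul₀ (by positivity)]
      simp only [smul_apply, SchwartzMap.compCLMOfContinuousLinearEquiv_apply,
        Function.comp_apply, smul_eq_mul, SchwartzMap.fourier_coe]
      rfl
    rw [hl, hscale, finrank_euclideanSpace, Fintype.card_fin]
    have hr : (fun y : Space => Complex.exp (Complex.I * (inner ℝ ξ ((2 * Real.pi) • y) : ℝ)) *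
        ((fourierFactor : ℂ) * 𝓕 (w : Space → ℂ) y)) = fun y => (fourierFactor : ℂ) *
        (Complex.exp (((2 * Real.pi * inner ℝ y ξ : ℝ) : ℂ) * Complex.I) •
          𝓕 (w : Space → ℂ) y) := by
      funext y
      rw [inner_smul_right, real_inner_comm, smul_eq_mul, mul_comm Complex.I]
      ring
    rw [hr, integral_const_mul, Complex.real_smul, ← fourierFactor, ← mul_assoc, ← mul_assoc]
    -- The two normalising factors cancel the Jacobian `(2π) ^ 3` of the dilation.
    have hone : (fourierFactor : ℂ) * ((2 * Real.pi) ^ 3 : ℝ) * fourierFactor = 1 := by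
      rw [← Complex.ofReal_mul, ← Complex.ofReal_mul, mul_right_comm, fourierFactor_mul_self,
        inv_mul_cancel₀ (by positivity), Complex.ofReal_one]
    rw [hone, one_mul]

theorem integral_comp_affine {E : Type*} [NormedAddCommGroup E] [NormedSpace ℝ E]
    (B : Space ≃L[ℝ] Space) (c : Space) (f : Space → E) :
    ∫ ξ, f ξ = |LinearMap.det (B : Space →ₗ[ℝ] Space)| • ∫ y, f (c + B y) := by
  have hdet : LinearMap.det (B : Space →ₗ[ℝ] Space) ≠ 0 :=
    (LinearEquiv.isUnit_det' B.toLinearEquiv).ne_zero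
  have h1 := B.toHomeomorph.measurableEmbedding.integral_map (μ := volume) fun ξ => f (c + ξ)
  have h2 := Measure.map_linearMap_addHaar_eq_smul_addHaar (volume : Measure Space) hdet
  have h3 : (⇑B.toHomeomorph : Space → Space) = ⇑(B : Space →ₗ[ℝ] Space) := rfl
  rw [h3, h2, integral_smul_measure, integral_add_left_eq_self f c,
    ENNReal.toReal_ofReal (abs_nonneg _), abs_inv] at h1
  change _ = ∫ y, f (c + B y) at h1
  rw [← h1, smul_inv_smul₀ (abs_ne_zero.2 hdet)]

theorem LinearMap.det_adjoint_space (B : Space →ₗ[ℝ] Space) :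
    LinearMap.det (LinearMap.adjoint B) = LinearMap.det B := by
  set b := (EuclideanSpace.basisFun (Fin 3) ℝ)
  rw [← LinearMap.det_toMatrix b.toBasis, ← LinearMap.det_toMatrix b.toBasis B,
    LinearMap.toMatrix_adjoint, Matrix.det_conjTranspose]
  simp

theorem eLpNorm_comp_affine {B : Space →ₗ[ℝ] Space} (hB : LinearMap.det B ≠ 0) (v : Space)
    {G : Space → ℂ} (hG : Continuous G) (p : ℝ≥0∞) :
    eLpNorm (fun x => G (B (x + v))) p volume
      = ENNReal.ofReal |(LinearMap.det B)⁻¹| ^ (1 / p).toReal * eLpNorm G p volume := by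
  have h1 := Measure.map_linearMap_addHaar_eq_smul_addHaar (volume : Measure Space) hB
  have hBm : Measurable B := B.continuous_of_finiteDimensional.measurable
  rw [← smul_eq_mul, ← eLpNorm_smul_measure_of_ne_zero (by simpa using hB), ← h1,
    eLpNorm_map_measure hG.aestronglyMeasurable hBm.aemeasurable]
  exact (eLpNorm_comp_measurePreserving
    ((hG.comp B.continuous_of_finiteDimensional).aestronglyMeasurable)
    (measurePreserving_add_right volume v))

/-! ### The Knapp-type test functions -/

/-- A fixed bump function supported in the unit ball. -/
noncomputable def unitBump : ContDiffBump (0 : Space) := ⟨1 / 2, 1, by norm_num, by norm_num⟩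

theorem unitBump_eq_zero {y : Space} (hy : y ∉ Metric.closedBall (0 : Space) 1) :
    unitBump y = 0 := by
  refine unitBump.zero_of_le_dist ?_
  rw [Metric.mem_closedBall, not_le] at hy
  exact hy.le

/-- A phase of size at most one allows no cancellation: `cos θ ≥ 1 - θ ^ 2 / 2 ≥ 1 / 2`, so the real
part already gives the bound. -/
theorem half_integral_le_norm_integral_exp {θ g : Space → ℝ}
    (hθ : ContinuousOn θ (Metric.closedBall 0 1)) (hθ1 : ∀ y ∈ Metric.closedBall 0 1, |θ y| ≤ 1)
    (hg : Continuous g) (hg0 : ∀ y, 0 ≤ g y) (hgs : ∀ y ∉ Metric.closedBall 0 1, g y = 0) :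
    1 / 2 * ∫ y, g y ≤ ‖∫ y, Complex.exp (Complex.I * (θ y : ℂ)) * (g y : ℂ)‖ := by
  have hK : IsCompact (Metric.closedBall (0 : Space) 1) := isCompact_closedBall 0 1
  have hint : Integrable (fun y => Complex.exp (Complex.I * (θ y : ℂ)) * (g y : ℂ)) := by
    refine IntegrableOn.integrable_of_forall_notMem_eq_zero
      (s := Metric.closedBall (0 : Space) 1) ?_ fun y hy => by simp [hgs y hy]
    refine ContinuousOn.integrableOn_compact hK ?_
    exact ((continuousOn_const.mul (Complex.continuous_ofReal.comp_continuousOn hθ)).cexp).mul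
      (Complex.continuous_ofReal.comp hg).continuousOn
  have hgint : Integrable g :=
    IntegrableOn.integrable_of_forall_notMem_eq_zero (hg.continuousOn.integrableOn_compact hK) hgs
  have hre (y : Space) : RCLike.re (Complex.exp (Complex.I * (θ y : ℂ)) * (g y : ℂ))
      = Real.cos (θ y) * g y := by
    rw [RCLike.re_eq_complex_re, Complex.re_mul_ofReal, mul_comm Complex.I,
      Complex.exp_ofReal_mul_I_re]
  calc 1 / 2 * ∫ y, g y = ∫ y, 1 / 2 * g y := (integral_const_mul _ _).symm
    _ ≤ ∫ y, RCLike.re (Complex.exp (Complex.I * (θ y : ℂ)) * (g y : ℂ)) := by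
        refine integral_mono (hgint.const_mul _) hint.re fun y => ?_
        rw [hre]
        by_cases hy : y ∈ Metric.closedBall (0 : Space) 1
        · refine mul_le_mul_of_nonneg_right ?_ (hg0 y)
          have h1 := Real.one_sub_sq_div_two_le_cos (x := θ y)
          have h2 : θ y ^ 2 ≤ 1 := (sq_le_one_iff_abs_le_one _).2 (hθ1 y hy)
          linarith
        · simp [hgs y hy]
    _ = RCLike.re (∫ y, Complex.exp (Complex.I * (θ y : ℂ)) * (g y : ℂ)) := integral_re hint
    _ ≤ _ := RCLike.re_le_norm _

/-- The Fourier transform of the test function attached to `ξ = c + B y`. -/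
noncomputable def knappSymbol (v : Space) (B : Space ≃L[ℝ] Space) (c ξ : Space) : ℂ :=
  Complex.exp (-(Complex.I * (inner ℝ ξ v : ℝ))) * (unitBump (B.symm (ξ - c)) : ℂ)

theorem contDiff_knappSymbol (v : Space) (B : Space ≃L[ℝ] Space) (c : Space) :
    ContDiff ℝ ∞ (knappSymbol v B c) := by
  have h1 : ContDiff ℝ ∞ fun ξ : Space => ((inner ℝ ξ v : ℝ) : ℂ) :=
    Complex.ofRealCLM.contDiff.comp (contDiff_id.inner ℝ contDiff_const)
  have h2 : ContDiff ℝ ∞ fun ξ : Space => ((unitBump (B.symm (ξ - c)) : ℝ) : ℂ) :=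
    Complex.ofRealCLM.contDiff.comp
      (unitBump.contDiff.comp (B.symm.contDiff.comp (contDiff_id.sub contDiff_const)))
  exact (contDiff_const.mul h1).neg.cexp.mul h2

theorem hasCompactSupport_knappSymbol (v : Space) (B : Space ≃L[ℝ] Space) (c : Space) :
    HasCompactSupport (knappSymbol v B c) := by
  refine HasCompactSupport.intro
    (((isCompact_closedBall (0 : Space) 1).image B.continuous).image (continuous_const_add c))
    fun ξ hξ => ?_
  have : B.symm (ξ - c) ∉ Metric.closedBall (0 : Space) 1 := fun h =>
    hξ ⟨_, ⟨_, h, rfl⟩, by simp⟩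
  rw [knappSymbol, unitBump_eq_zero this, Complex.ofReal_zero, mul_zero]

theorem knappSymbol_affine (v : Space) (B : Space ≃L[ℝ] Space) (c y : Space) :
    knappSymbol v B c (c + B y) =
      Complex.exp (-(Complex.I * (inner ℝ (c + B y) v : ℝ))) * (unitBump y : ℂ) := by
  rw [knappSymbol, add_sub_cancel_left, B.symm_apply_apply]

theorem inner_affine (B : Space ≃L[ℝ] Space) (c y x : Space) :
    inner ℝ (c + B y) x =
      inner ℝ c x + inner ℝ y (LinearMap.adjoint (B : Space →ₗ[ℝ] Space) x) := by
  rw [inner_add_left, LinearMap.adjoint_inner_right]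
  rfl

/-- Up to a unimodular factor every test function is one fixed function, transported by an affine
map and multiplied by `|det B|`; its `L^p` norm is then a matter of scaling. -/
theorem fourierOpInv_knappSymbol (v : Space) (B : Space ≃L[ℝ] Space) (c x : Space) :
    fourierOpInv (knappSymbol v B c) x =
      |LinearMap.det (B : Space →ₗ[ℝ] Space)| *
        Complex.exp (-(Complex.I * (inner ℝ c (x + v) : ℝ))) *
        fourierOpInv (fun y => (unitBump y : ℂ))
          (LinearMap.adjoint (B : Space →ₗ[ℝ] Space) (x + v)) := by
  rw [fourierOpInv, integral_comp_affine B c, fourierOpInv]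
  have : (fun y => Complex.exp (-(Complex.I * (inner ℝ (c + B y) x : ℝ))) *
      knappSymbol v B c (c + B y)) = fun y =>
      Complex.exp (-(Complex.I * (inner ℝ c (x + v) : ℝ))) *
        (Complex.exp (-(Complex.I *
          (inner ℝ y (LinearMap.adjoint (B : Space →ₗ[ℝ] Space) (x + v)) : ℝ))) *
          (unitBump y : ℂ)) := by
    funext y
    rw [knappSymbol_affine, ← mul_assoc, ← mul_assoc, ← Complex.exp_add, ← Complex.exp_add,
      inner_affine, inner_affine, map_add, inner_add_right, inner_add_right]
    push_cast
    ring_nf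
  rw [this, integral_const_mul, Complex.real_smul]
  ring

/-- The modulation in `knappSymbol` cancels the linear part of `φ`. Apart from a factor independent
of `y`, the phase left is the sum of `φ - ⟪·, v⟫` and `⟪y, Bᵗ x⟫`, each at most `1 / 2` in absolute
value. -/
theorem le_norm_convOp_knapp {φ a : Space → ℝ} {v : Space} {B : Space ≃L[ℝ] Space} {c : Space}
    {A : ℝ} (ha : Continuous a) (ha0 : ∀ ξ, 0 ≤ a ξ)
    (hφ : ContinuousOn (fun y => φ (c + B y)) (Metric.closedBall 0 1))
    (hphase : ∀ y ∈ Metric.closedBall (0 : Space) 1,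
      |φ (c + B y) - inner ℝ (c + B y) v| ≤ 1 / 2)
    (hA : ∀ y ∈ Metric.closedBall (0 : Space) 1, A ≤ a (c + B y))
    {u : Space → ℂ} (hu : fourierOp u = knappSymbol v B c) {x : Space}
    (hx : ‖LinearMap.adjoint (B : Space →ₗ[ℝ] Space) x‖ ≤ 1 / 2) :
    |LinearMap.det (B : Space →ₗ[ℝ] Space)| * A * (fourierFactor * (1 / 2 * ∫ y, unitBump y))
      ≤ ‖convOp φ (fun ξ => (a ξ : ℂ)) u x‖ := by
  set Bx := LinearMap.adjoint (B : Space →ₗ[ℝ] Space) x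
  set θ : Space → ℝ := fun y => φ (c + B y) - inner ℝ (c + B y) v - inner ℝ y Bx with hθ
  have hcB : Continuous fun y : Space => c + B y := by fun_prop
  have hlow := half_integral_le_norm_integral_exp (θ := θ) (g := fun y => a (c + B y) * unitBump y)
    ((hφ.sub (by fun_prop)).sub (by fun_prop)) (fun y hy => ?_)
    ((ha.comp hcB).mul unitBump.continuous)
    (fun y => mul_nonneg (ha0 _) unitBump.nonneg) (fun y hy => by simp [unitBump_eq_zero hy])
  · have hmono : A * ∫ y, unitBump y ≤ ∫ y, a (c + B y) * unitBump y := by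
      rw [← integral_const_mul]
      refine integral_mono
        (unitBump.integrable.const_mul _) ?_ fun y => ?_
      · exact ((ha.comp hcB).mul unitBump.continuous).integrable_of_hasCompactSupport
          unitBump.hasCompactSupport.mul_left
      · by_cases hy : y ∈ Metric.closedBall (0 : Space) 1
        · exact mul_le_mul_of_nonneg_right (hA y hy) unitBump.nonneg
        · simp [unitBump_eq_zero hy]
    have hval : convOp φ (fun ξ => (a ξ : ℂ)) u x =
        fourierFactor * (|LinearMap.det (B : Space →ₗ[ℝ] Space)| *
          (Complex.exp (((-inner ℝ c x : ℝ) : ℂ) * Complex.I) *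
            ∫ y, Complex.exp (Complex.I * (θ y : ℂ)) * ((a (c + B y) * unitBump y : ℝ) : ℂ))) := by
      rw [convOp, hu, fourierOpInv, integral_comp_affine B c, Complex.real_smul,
        ← integral_const_mul (Complex.exp _)]
      refine congrArg _ (congrArg _ (congrArg _ ?_))
      funext y
      simp only [knappSymbol_affine, hθ]
      rw [inner_affine B c y x, Complex.ofReal_mul]
      have h (p q r s t z w : ℂ) (h : p + q + r = s + t) :
          Complex.exp p * (Complex.exp q * z * (Complex.exp r * w))
            = Complex.exp s * (Complex.exp t * (z * w)) := by
        calc _ = Complex.exp p * Complex.exp q * Complex.exp r * (z * w) := by ring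
          _ = Complex.exp s * Complex.exp t * (z * w) := by
            rw [← Complex.exp_add, ← Complex.exp_add, ← Complex.exp_add, h]
          _ = _ := by ring
      refine h _ _ _ _ _ _ _ ?_
      push_cast
      ring
    rw [hval, norm_mul, norm_mul, norm_mul, Complex.norm_exp_ofReal_mul_I, one_mul,
      Complex.norm_real, Complex.norm_real, Real.norm_of_nonneg fourierFactor_pos.le, norm_abs_eq_norm,
      Real.norm_eq_abs]
    calc _ = fourierFactor * (|LinearMap.det (B : Space →ₗ[ℝ] Space)| *
          (1 / 2 * (A * ∫ y, unitBump y))) := by ring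
      _ ≤ _ := by
        have := fourierFactor_pos
        gcongr
        exact (mul_le_mul_of_nonneg_left hmono (by norm_num)).trans hlow
  · have h1 := hphase y hy
    have h2 : |inner ℝ y Bx| ≤ 1 / 2 := by
      refine (abs_real_inner_le_norm _ _).trans ?_
      rw [mem_closedBall_zero_iff] at hy
      nlinarith [norm_nonneg y, norm_nonneg Bx]
    calc |θ y| ≤ _ := abs_sub _ _
      _ ≤ 1 := by linarith

theorem one_div_toReal_conjExponent {p : ℝ} (hp : 1 ≤ p) :
    1 / ((ENNReal.ofReal p).conjExponent).toReal = 1 - 1 / p := by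
  have hp0 : 0 < p := by linarith
  rw [ENNReal.conjExponent, ← ENNReal.ofReal_one, ← ENNReal.ofReal_sub _ zero_le_one]
  rcases hp.eq_or_lt with rfl | hp
  -- At `p = 1` the conjugate exponent is `⊤`, with `toReal` zero, and `1 / 0 = 0` is the right
  -- value.
  · simp
  · rw [← ENNReal.ofReal_inv_of_pos (by linarith), ← ENNReal.ofReal_add zero_le_one
      (by rw [inv_nonneg]; linarith), ENNReal.toReal_ofReal (by
        have : 0 ≤ (p - 1)⁻¹ := by rw [inv_nonneg]; linarith
        linarith)]
    have : p - 1 ≠ 0 := by linarith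
    field_simp
    ring

/-- Testing a bounded operator on the Knapp-type functions. -/
theorem exists_knapp_bound {φ a : Space → ℝ} {p : ℝ} (hp : 1 ≤ p)
    (hbd : ConvOpBounded φ (fun ξ => (a ξ : ℂ)) (ENNReal.ofReal p))
    (ha : Continuous a) (ha0 : ∀ ξ, 0 ≤ a ξ) (v : Space) :
    ∃ C : ℝ, ∀ (B : Space ≃L[ℝ] Space) (c : Space) (A : ℝ), 0 ≤ A →
      ContinuousOn (fun y => φ (c + B y)) (Metric.closedBall 0 1) →
      (∀ y ∈ Metric.closedBall (0 : Space) 1, |φ (c + B y) - inner ℝ (c + B y) v| ≤ 1 / 2) →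
      (∀ y ∈ Metric.closedBall (0 : Space) 1, A ≤ a (c + B y)) →
      A * |LinearMap.det (B : Space →ₗ[ℝ] Space)| ^ (2 / p - 1) ≤ C := by
  obtain ⟨C, hC⟩ := hbd
  have hp0 : 0 < p := by linarith
  obtain ⟨G, hG, -⟩ := exists_schwartz_fourierOpInv
    ((unitBump.hasCompactSupport.comp_left (g := ((↑) : ℝ → ℂ)) Complex.ofReal_zero).toSchwartzMap
      (Complex.ofRealCLM.contDiff.comp unitBump.contDiff))
  have hG : ⇑G = fourierOpInv fun y => (unitBump y : ℂ) := hG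
  set N : ℝ := (eLpNorm G (ENNReal.ofReal p) volume).toReal with hN
  have hNtop : eLpNorm G (ENNReal.ofReal p) volume ≠ ⊤ := (G.eLpNorm_lt_top _ _).ne
  set V : ℝ := (volume (Metric.closedBall (0 : Space) (1 / 2))).toReal with hV
  have hVtop : volume (Metric.closedBall (0 : Space) (1 / 2)) ≠ ⊤ := measure_closedBall_lt_top.ne
  have hVpos : 0 < volume (Metric.closedBall (0 : Space) (1 / 2)) :=
    Metric.measure_closedBall_pos _ _ (by norm_num)
  have hV0 : 0 < V := ENNReal.toReal_pos hVpos.ne' hVtop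
  set κ : ℝ := fourierFactor * (1 / 2 * ∫ y, unitBump y) with hκ
  have hκ0 : 0 < κ := mul_pos fourierFactor_pos (mul_pos (by norm_num) unitBump.integral_pos)
  -- The constant involves only the operator bound, `p` and the fixed bump, hence is uniform over
  -- all boxes.
  refine ⟨C * N / (κ * V ^ (1 - 1 / p)), fun B c A hA0 hφ hphase hA => ?_⟩
  obtain ⟨u, hu, hFu⟩ := exists_schwartz_fourierOpInv
    ((hasCompactSupport_knappSymbol v B c).toSchwartzMap (contDiff_knappSymbol v B c))
  have hu : ⇑u = fourierOpInv (knappSymbol v B c) := hu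
  have hFu : fourierOp u = knappSymbol v B c := hFu
  set D := |LinearMap.det (B : Space →ₗ[ℝ] Space)| with hD
  set Bt := LinearMap.adjoint (B : Space →ₗ[ℝ] Space) with hBt
  have hdet : LinearMap.det (B : Space →ₗ[ℝ] Space) ≠ 0 :=
    (LinearEquiv.isUnit_det' B.toLinearEquiv).ne_zero
  have hdett : LinearMap.det Bt ≠ 0 := by rwa [hBt, LinearMap.det_adjoint_space]
  have hDt : |(LinearMap.det Bt)⁻¹| = D⁻¹ := by rw [abs_inv, hBt, LinearMap.det_adjoint_space]
  have hD0 : 0 < D := abs_pos.2 hdet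
  have hupper : eLpNorm u (ENNReal.ofReal p) volume =
      ENNReal.ofReal (D * (D⁻¹ ^ (1 / p) * N)) := by
    have h1 : eLpNorm u (ENNReal.ofReal p) volume =
        eLpNorm (D • fun x => G (Bt (x + v))) (ENNReal.ofReal p) volume := by
      refine eLpNorm_congr_norm_ae (ae_of_all _ fun x => ?_)
      rw [hu, fourierOpInv_knappSymbol, hG, norm_mul, norm_mul, Pi.smul_apply, norm_smul,
        Complex.norm_real]
      have : ‖Complex.exp (-(Complex.I * (inner ℝ c (x + v) : ℝ)))‖ = 1 := by
        rw [Complex.norm_exp]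
        simp
      rw [this, mul_one]
    rw [h1, eLpNorm_const_smul, eLpNorm_comp_affine hdett v G.continuous, hDt, one_div,
      ENNReal.toReal_inv, ENNReal.toReal_ofReal hp0.le, ENNReal.ofReal_rpow_of_pos (by positivity),
      ENNReal.ofReal_mul hD0.le, ENNReal.ofReal_mul (by positivity), ENNReal.ofReal_toReal hNtop,
      Real.enorm_of_nonneg hD0.le, one_div]
  have hlower : ENNReal.ofReal (D * A * κ * (D⁻¹ * V) ^ (1 - 1 / p)) ≤
      eLpNorm (convOp φ (fun ξ => (a ξ : ℂ)) u) (ENNReal.ofReal p).conjExponent volume := by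
    -- The set dual to the box, of volume `V / D`, on which the image is at least `D * A * κ`.
    set E : Set Space := Bt ⁻¹' Metric.closedBall 0 (1 / 2) with hE
    have hEm : MeasurableSet E :=
      Bt.continuous_of_finiteDimensional.measurable measurableSet_closedBall
    have hEv : volume E = ENNReal.ofReal (D⁻¹ * V) := by
      rw [hE, Measure.addHaar_preimage_linearMap _ hdett, hDt, ENNReal.ofReal_mul (by positivity),
        ENNReal.ofReal_toReal hVtop]
    have hq0 : (ENNReal.ofReal p).conjExponent ≠ 0 := by
      rw [ENNReal.conjExponent]
      simp
    have hind := eLpNorm_indicator_const' (μ := volume) (p := (ENNReal.ofReal p).conjExponent)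
      (c := D * A * κ) hEm (by rw [hEv]; simp; positivity) hq0
    rw [hEv, one_div_toReal_conjExponent hp, Real.enorm_of_nonneg (by positivity),
      ENNReal.ofReal_rpow_of_pos (by positivity), ← ENNReal.ofReal_mul (by positivity)] at hind
    rw [← hind]
    refine eLpNorm_mono fun x => ?_
    by_cases hx : x ∈ E
    · rw [Set.indicator_of_mem hx, Real.norm_of_nonneg (by positivity)]
      exact le_norm_convOp_knapp ha ha0 hφ hphase hA hFu (mem_closedBall_zero_iff.1 hx)
    · rw [Set.indicator_of_notMem hx, norm_zero]
      exact norm_nonneg _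
  have hmain := hlower.trans (hC u)
  rw [hupper, ← ENNReal.ofReal_coe_nnreal, ← ENNReal.ofReal_mul C.coe_nonneg,
    ENNReal.ofReal_le_ofReal_iff (by positivity)] at hmain
  rw [le_div_iff₀ (by positivity)]
  have e1 : (D⁻¹ * V) ^ (1 - 1 / p) = D ^ (1 / p - 1) * V ^ (1 - 1 / p) := by
    rw [Real.mul_rpow (by positivity) hV0.le, Real.inv_rpow hD0.le, ← Real.rpow_neg hD0.le,
      neg_sub]
  have e2 : D⁻¹ ^ (1 / p) = D ^ (-(1 / p)) := by
    rw [Real.inv_rpow hD0.le, ← Real.rpow_neg hD0.le]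
  have e3 : D ^ (2 / p - 1) = D ^ (1 / p - 1) * D ^ (1 / p) := by
    rw [← Real.rpow_add hD0]
    ring_nf
  have e4 : D ^ (-(1 / p)) * D ^ (1 / p) = 1 := by
    rw [← Real.rpow_add hD0, neg_add_cancel, Real.rpow_zero]
  rw [e1, e2] at hmain
  have hmain' : A * κ * D ^ (1 / p - 1) * V ^ (1 - 1 / p) ≤ C * N * D ^ (-(1 / p)) := by
    refine le_of_mul_le_mul_left ?_ hD0
    linarith
  calc A * D ^ (2 / p - 1) * (κ * V ^ (1 - 1 / p))
      = A * κ * D ^ (1 / p - 1) * V ^ (1 - 1 / p) * D ^ (1 / p) := by rw [e3]; ring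
    _ ≤ C * N * D ^ (-(1 / p)) * D ^ (1 / p) := by gcongr
    _ = C * N := by rw [mul_assoc, e4, mul_one]

/-! ### The adapted boxes -/

/-- A linear map of the plane, extended to space by the identity on the last coordinate. -/
noncomputable def extendLinear (T : Plane ≃L[ℝ] Plane) : Space →ₗ[ℝ] Space where
  toFun y := !₂[T !₂[y 0, y 1] 0, T !₂[y 0, y 1] 1, y 2]
  map_add' x y := by
    have : (!₂[x 0 + y 0, x 1 + y 1] : Plane) = !₂[x 0, x 1] + !₂[y 0, y 1] := by
      ext i; fin_cases i <;> simp
    ext i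
    fin_cases i <;> simp [this]
  map_smul' t x := by
    have : (!₂[t * x 0, t * x 1] : Plane) = t • !₂[x 0, x 1] := by
      ext i; fin_cases i <;> simp
    ext i
    fin_cases i <;> simp [this]

theorem extendLinear_apply (T : Plane ≃L[ℝ] Plane) (y : Space) :
    extendLinear T y = !₂[T !₂[y 0, y 1] 0, T !₂[y 0, y 1] 1, y 2] := rfl

theorem det_extendLinear_ne_zero (T : Plane ≃L[ℝ] Plane) : LinearMap.det (extendLinear T) ≠ 0 := by
  have hinj : Function.Injective (extendLinear T) := by
    rw [← LinearMap.ker_eq_bot, LinearMap.ker_eq_bot']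
    intro y hy
    rw [extendLinear_apply] at hy
    have h0 := congrArg (fun z : Space => z 0) hy
    have h1 := congrArg (fun z : Space => z 1) hy
    have h2 := congrArg (fun z : Space => z 2) hy
    simp at h0 h1 h2
    have hT : T !₂[y 0, y 1] = 0 := by
      ext i; fin_cases i <;> simp [h0, h1]
    have hp : (!₂[y 0, y 1] : Plane) = 0 := T.map_eq_zero_iff.1 hT
    have g0 := congrArg (fun z : Plane => z 0) hp
    have g1 := congrArg (fun z : Plane => z 1) hp
    simp at g0 g1
    ext i; fin_cases i <;> simp [g0, g1, h2]
  exact (LinearEquiv.isUnit_det' (LinearEquiv.ofInjectiveEndo _ hinj)).ne_zero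

theorem exists_boxMap (T : Plane ≃L[ℝ] Plane) (δ : Fin 3 → ℝ) (hδ : ∀ i, 0 < δ i) :
    ∃ B : Space ≃L[ℝ] Space,
      (∀ y, B y = extendLinear T !₂[δ 0 * y 0, δ 1 * y 1, δ 2 * y 2]) ∧
      |LinearMap.det (B : Space →ₗ[ℝ] Space)|
        = |LinearMap.det (extendLinear T)| * (δ 0 * δ 1 * δ 2) := by
  set E : Space →ₗ[ℝ] Space := Matrix.toEuclideanLin (Matrix.diagonal δ) with hE
  have hEdet : LinearMap.det E = δ 0 * δ 1 * δ 2 := by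
    rw [hE, Matrix.toEuclideanLin_eq_toLin_orthonormal, LinearMap.det_toLin, Matrix.det_diagonal,
      Fin.prod_univ_three]
  have hpos : 0 < δ 0 * δ 1 * δ 2 := mul_pos (mul_pos (hδ 0) (hδ 1)) (hδ 2)
  have hdet : LinearMap.det (extendLinear T ∘ₗ E) ≠ 0 := by
    rw [LinearMap.det_comp, hEdet]
    exact mul_ne_zero (det_extendLinear_ne_zero T) hpos.ne'
  refine ⟨((extendLinear T ∘ₗ E).equivOfDetNeZero hdet).toContinuousLinearEquiv, fun y => ?_, ?_⟩
  · change extendLinear T (E y) = _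
    congr 1
    ext i
    refine (Matrix.mulVec_diagonal δ y.ofLp i).trans ?_
    fin_cases i <;> rfl
  · change |LinearMap.det (extendLinear T ∘ₗ E)| = _
    rw [LinearMap.det_comp, hEdet, abs_mul, abs_of_pos hpos]

/-- The point `ξ / φ ξ` lies on the level surface, so its last coordinate is `1 + ϕ` of the first
two. -/
theorem sub_eq_neg_mul_of_graph {φ : Space → ℝ} {Γ₀ : Set Space}
    (hcone : ∀ ξ ∈ Γ₀, ∀ t : ℝ, 0 < t → t • ξ ∈ Γ₀) (hφ_pos : ∀ ξ ∈ Γ₀, 0 < φ ξ)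
    (hφ_hom : ∀ ξ ∈ Γ₀, ∀ t : ℝ, 0 < t → φ (t • ξ) = t * φ ξ) {ϕ : Plane → ℝ} {U : Set Plane}
    (hgraph : {ξ | ξ ∈ Γ₀ ∧ φ ξ = 1} = {ξ | ∃ x ∈ U, ξ = !₂[x 0, x 1, 1 + ϕ x]})
    {ξ : Space} (hξ : ξ ∈ Γ₀) :
    φ ξ - ξ 2 = -(φ ξ * ϕ ((φ ξ)⁻¹ • !₂[ξ 0, ξ 1])) := by
  have hs := hφ_pos ξ hξ
  have hmem : (φ ξ)⁻¹ • ξ ∈ {ξ | ξ ∈ Γ₀ ∧ φ ξ = 1} :=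
    ⟨hcone ξ hξ _ (inv_pos.2 hs), by
      rw [hφ_hom ξ hξ _ (inv_pos.2 hs), inv_mul_cancel₀ hs.ne']⟩
  rw [hgraph] at hmem
  obtain ⟨x, -, hx⟩ := hmem
  have h0 := congrArg (fun z : Space => z 0) hx
  have h1 := congrArg (fun z : Space => z 1) hx
  have h2 := congrArg (fun z : Space => z 2) hx
  simp at h0 h1 h2
  have hxe : (φ ξ)⁻¹ • !₂[ξ 0, ξ 1] = x := by
    ext i; fin_cases i <;> simp [h0, h1]
  rw [hxe]
  have : ξ 2 = φ ξ * (1 + ϕ x) := by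
    rw [← h2, mul_inv_cancel_left₀ hs.ne']
  rw [this]
  ring

theorem norm_lt_of_abs_le {z : Space} {δ : ℝ} (hδ : 0 < δ) (h : ∀ i, |z i| ≤ δ) :
    ‖z‖ < 2 * δ := by
  refine lt_of_pow_lt_pow_left₀ 2 (by positivity) ?_
  rw [EuclideanSpace.real_norm_sq_eq, Fin.sum_univ_three]
  have hsq (i) : z i ^ 2 ≤ δ ^ 2 := sq_le_sq' (abs_le.1 (h i)).1 (abs_le.1 (h i)).2
  nlinarith [hsq 0, hsq 1, hsq 2, pow_pos hδ 2]

theorem nonpos_of_forall_rpow_le {e C : ℝ} (h : ∀ t : ℝ, 1 ≤ t → t ^ e ≤ C) : e ≤ 0 := by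
  by_contra! he
  obtain ⟨t, ht, ht1⟩ := (((tendsto_rpow_atTop he).eventually_gt_atTop C).and
    (Filter.eventually_ge_atTop 1)).exists
  exact absurd (h t ht1) (not_le.2 ht)

/-- The Knapp test in one linear coordinate system, on boxes of frequency `lam → ∞`. -/
theorem order_ge_of_lt_newtonDistance
    {p : ℝ} (hp₁ : 1 ≤ p) {φ : Space → ℝ} {Γ₀ : Set Space} (hΓ₀ : IsConicNhd Γ₀ !₂[0, 0, 1])
    (hφ_smooth : ContDiffOn ℝ ∞ φ Γ₀) (hφ_pos : ∀ ξ ∈ Γ₀, 0 < φ ξ)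
    (hφ_hom : ∀ ξ ∈ Γ₀, ∀ t : ℝ, 0 < t → φ (t • ξ) = t * φ ξ)
    {ϕ : Plane → ℝ} {U : Set Plane} (hU : IsOpen U) (h0U : (0 : Plane) ∈ U)
    (hϕ_smooth : ContDiffOn ℝ ∞ ϕ U) (hϕ_zero : ϕ 0 = 0)
    (hgraph : {ξ | ξ ∈ Γ₀ ∧ φ ξ = 1} = {ξ | ∃ x ∈ U, ξ = !₂[x 0, x 1, 1 + ϕ x]})
    {k : ℝ} (hk : 0 < k) {Γ : Set Space} (hΓ : IsConicNhd Γ !₂[0, 0, 1])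
    (hbd : ∀ a ∈ classicalSymbolsIn (-k) Γ, ConvOpBounded φ a (ENNReal.ofReal p))
    (T : Plane ≃L[ℝ] Plane) {d : ℝ} (hd0 : 0 < d) (hd : (d : EReal) < newtonDistance (ϕ ∘ T)) :
    (6 - 2 / d) * (1 / p - 1 / 2) ≤ k := by
  set v : Space := !₂[0, 0, 1] with hv
  have hv1 : ‖v‖ = 1 := by
    rw [hv, EuclideanSpace.norm_eq, Fin.sum_univ_three]
    simp
  have hinner (ξ : Space) : inner ℝ ξ v = ξ 2 := by
    rw [hv, PiLp.inner_apply, Fin.sum_univ_three]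
    simp
  have hϕT : ContDiffAt ℝ ∞ (ϕ ∘ T) 0 := by
    refine ContDiffAt.comp 0 ?_ T.contDiff.contDiffAt
    rw [map_zero]
    exact hϕ_smooth.contDiffAt (hU.mem_nhds h0U)
  -- With `ε = 1 / 4` and `φ η < 2` near `v`, the phase error is at most `lam * 2 * (1 / 4 / lam) =
  -- 1 / 2`.
  obtain ⟨κ, hκ, hκsum, r, hr, hbox⟩ := exists_box_abs_le hϕT (by simp [hϕ_zero]) hd0 hd
    (show (0 : ℝ) < 1 / 4 by norm_num)
  obtain ⟨a, ha, ha0, hae⟩ := exists_elliptic_symbol hΓ hv1 (-k)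
  have hacont : Continuous a := by
    exact Complex.continuous_re.comp ha.1.1.continuous
  obtain ⟨C, hC⟩ := exists_knapp_bound hp₁ (hbd _ ha) hacont ha0 v
  have hφv : φ v = 1 := by
    have : v ∈ {ξ | ξ ∈ Γ₀ ∧ φ ξ = 1} := by
      rw [hgraph]
      exact ⟨0, h0U, by simp [hϕ_zero, hv]⟩
    exact this.2
  have hφc : ContinuousAt φ v := (hφ_smooth.contDiffAt (hΓ₀.1.mem_nhds hΓ₀.2.1)).continuousAt
  have hnear : ∀ᶠ η in nhds v, η ∈ Γ₀ ∧ 1 / 2 < φ η ∧ φ η < 2 ∧ ‖η‖ < 2 ∧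
      ∀ t : ℝ, 1 ≤ t → a (t • η) = t ^ (-k) * ‖η‖ ^ (-k) := by
    filter_upwards [hΓ₀.1.mem_nhds hΓ₀.2.1,
      hφc.eventually (lt_mem_nhds (show (1 / 2 : ℝ) < φ v by rw [hφv]; norm_num)),
      hφc.eventually (gt_mem_nhds (show φ v < 2 by rw [hφv]; norm_num)),
      continuous_norm.continuousAt.eventually (gt_mem_nhds (show ‖v‖ < 2 by rw [hv1]; norm_num)),
      hae] with η h1 h2 h3 h4 h5 using ⟨h1, h2, h3, h4, h5⟩
  have hS : ContinuousAt (fun z : Space => v + extendLinear T z) 0 :=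
    (continuous_const.add (extendLinear T).continuous_of_finiteDimensional).continuousAt
  obtain ⟨δ, hδ, hδn⟩ := Metric.eventually_nhds_iff.1
    (hS.eventually (p := fun η => η ∈ Γ₀ ∧ 1 / 2 < φ η ∧ φ η < 2 ∧ ‖η‖ < 2 ∧
      ∀ t : ℝ, 1 ≤ t → a (t • η) = t ^ (-k) * ‖η‖ ^ (-k)) (by simpa using hnear))
  -- The bound `r / 2` compensates the factor `(φ η)⁻¹ ≤ 2` in the argument of `ϕ`; `δ / 2` keeps
  -- the box, of norm below `2 * r₀`, inside the `δ`-ball.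
  set r₀ : ℝ := min (r / 2) (δ / 2) with hr₀
  have hr₀0 : 0 < r₀ := by positivity
  set J : ℝ := |LinearMap.det (extendLinear T)| with hJ
  have hJ0 : 0 < J := abs_pos.2 (det_extendLinear_ne_zero T)
  have key (lam : ℝ) (hlam : 1 ≤ lam) :
      lam ^ (-k) * 2 ^ (-k) * (J * (r₀ ^ 3 * lam ^ (3 - 1 / d))) ^ (2 / p - 1) ≤ C := by
    have hlam0 : 0 < lam := one_pos.trans_le hlam
    obtain ⟨B, hB, hBdet⟩ := exists_boxMap T
      ![lam * (r₀ * lam ^ (-κ 0)), lam * (r₀ * lam ^ (-κ 1)), lam * r₀]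
      (by intro i; fin_cases i <;> simp <;> positivity)
    set z : Space → Space :=
      fun y => !₂[r₀ * lam ^ (-κ 0) * y 0, r₀ * lam ^ (-κ 1) * y 1, r₀ * y 2] with hz
    have hBz (y : Space) : lam • v + B y = lam • (v + extendLinear T (z y)) := by
      rw [hB, smul_add, ← map_smul]
      congr 2
      ext i
      fin_cases i <;> simp [hz] <;> ring
    have hdet : |LinearMap.det (B : Space →ₗ[ℝ] Space)| = J * (r₀ ^ 3 * lam ^ (3 - 1 / d)) := by
      rw [hBdet, ← hκsum, show (3 : ℝ) - (κ 0 + κ 1) = 3 + (-κ 0) + (-κ 1) by ring,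
        Real.rpow_add hlam0, Real.rpow_add hlam0]
      simp only [Matrix.cons_val_zero, Matrix.cons_val_one, Matrix.cons_val]
      rw [show lam ^ (3 : ℝ) = lam ^ 3 by exact_mod_cast Real.rpow_natCast lam 3]
      ring
    have hyi {y : Space} (hy : y ∈ Metric.closedBall (0 : Space) 1) (i) : |y i| ≤ 1 :=
      (PiLp.norm_apply_le y i).trans (mem_closedBall_zero_iff.1 hy)
    have hpow (i) : lam ^ (-κ i) ≤ 1 :=
      Real.rpow_le_one_of_one_le_of_nonpos hlam (neg_nonpos.2 (hκ i).le)
    have hpow0 (i) : 0 < lam ^ (-κ i) := Real.rpow_pos_of_pos hlam0 _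
    have hz0 {y : Space} (hy : y ∈ Metric.closedBall (0 : Space) 1) :
        |z y 0| ≤ r₀ * lam ^ (-κ 0) := by
      simp only [hz, PiLp.toLp_apply, Matrix.cons_val_zero]
      rw [abs_mul, abs_of_pos (mul_pos hr₀0 (hpow0 0))]
      exact mul_le_of_le_one_right (mul_pos hr₀0 (hpow0 0)).le (hyi hy 0)
    have hz1 {y : Space} (hy : y ∈ Metric.closedBall (0 : Space) 1) :
        |z y 1| ≤ r₀ * lam ^ (-κ 1) := by
      simp only [hz, PiLp.toLp_apply, Matrix.cons_val_one, Matrix.cons_val_zero]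
      rw [abs_mul, abs_of_pos (mul_pos hr₀0 (hpow0 1))]
      exact mul_le_of_le_one_right (mul_pos hr₀0 (hpow0 1)).le (hyi hy 1)
    have hz2 {y : Space} (hy : y ∈ Metric.closedBall (0 : Space) 1) : |z y 2| ≤ r₀ := by
      simp only [hz, PiLp.toLp_apply, Matrix.cons_val]
      rw [abs_mul, abs_of_pos hr₀0]
      exact mul_le_of_le_one_right hr₀0.le (hyi hy 2)
    have hη {y : Space} (hy : y ∈ Metric.closedBall (0 : Space) 1) :=
      hδn (y := z y) (by
        rw [dist_zero_right]
        refine (norm_lt_of_abs_le hr₀0 fun i => ?_).trans_le (by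
          have := min_le_right (r / 2) (δ / 2)
          rw [← hr₀] at this
          linarith)
        fin_cases i
        · exact (hz0 hy).trans (mul_le_of_le_one_right hr₀0.le (hpow 0))
        · exact (hz1 hy).trans (mul_le_of_le_one_right hr₀0.le (hpow 1))
        · exact hz2 hy)
    rw [← hdet]
    refine hC B (lam • v) _ (by positivity) ?_ (fun y hy => ?_) (fun y hy => ?_)
    · refine hφ_smooth.continuousOn.comp (by fun_prop) fun y hy => ?_
      rw [hBz]
      exact hΓ₀.2.2 _ (hη hy).1 lam hlam0
    · obtain ⟨hΓη, hφ1, hφ2, -, -⟩ := hη hy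
      rw [hinner, hBz]
      set η := v + extendLinear T (z y) with hηdef
      rw [sub_eq_neg_mul_of_graph hΓ₀.2.2 hφ_pos hφ_hom hgraph (hΓ₀.2.2 _ hΓη lam hlam0), abs_neg,
        abs_mul, hφ_hom η hΓη lam hlam0, abs_of_pos (mul_pos hlam0 (hφ_pos η hΓη))]
      -- By homogeneity `lam` drops out of the argument of `ϕ`, and `x` is that argument in the
      -- coordinates `T`.
      set x : Plane := (φ η)⁻¹ • !₂[z y 0, z y 1] with hx
      have hxT : (lam * φ η)⁻¹ • !₂[(lam • η) 0, (lam • η) 1] = T x := by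
        have h1 : (!₂[(lam • η) 0, (lam • η) 1] : Plane) = lam • T !₂[z y 0, z y 1] := by
          ext i
          fin_cases i <;> simp [hηdef, hv, extendLinear_apply]
        rw [h1, smul_smul, hx, map_smul, mul_inv, mul_right_comm, inv_mul_cancel₀ hlam0.ne',
          one_mul]
      have hxi (i) : |x i| ≤ r * lam ^ (-κ i) := by
        have hinv : (φ η)⁻¹ ≤ 2 := by
          rw [inv_le_comm₀ (hφ_pos η hΓη) two_pos]
          linarith
        have hr2 : 2 * r₀ ≤ r := by
          have := min_le_left (r / 2) (δ / 2)
          rw [← hr₀] at this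
          linarith
        have hstep (t : ℝ) (ht : |t| ≤ r₀ * lam ^ (-κ i)) :
            |(φ η)⁻¹ * t| ≤ r * lam ^ (-κ i) := by
          rw [abs_mul, abs_of_pos (inv_pos.2 (hφ_pos η hΓη))]
          calc _ ≤ 2 * (r₀ * lam ^ (-κ i)) :=
                mul_le_mul hinv ht (abs_nonneg _) zero_le_two
            _ = 2 * r₀ * lam ^ (-κ i) := by ring
            _ ≤ _ := mul_le_mul_of_nonneg_right hr2 (hpow0 i).le
        fin_cases i
        · exact hstep _ (hz0 hy)
        · exact hstep _ (hz1 hy)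
      rw [hxT]
      have hb : |ϕ (T x)| ≤ 1 / 4 / lam := hbox lam hlam x hxi
      calc lam * φ η * |ϕ (T x)| ≤ lam * 2 * (1 / 4 / lam) := by gcongr
        _ = 1 / 2 := by field_simp; norm_num
    · obtain ⟨-, hφ1, -, hnorm, hell⟩ := hη hy
      rw [hBz, hell lam hlam]
      refine mul_le_mul_of_nonneg_left ?_ (by positivity)
      -- At the origin homogeneity would give `φ 0 = 2 * φ 0`, against `φ > 1 / 2`.
      have hpos : 0 < ‖v + extendLinear T (z y)‖ := by
        rw [norm_pos_iff]
        intro h0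
        have := hφ_hom _ (hη hy).1 2 two_pos
        rw [h0, smul_zero] at this
        rw [h0] at hφ1
        linarith
      exact Real.rpow_le_rpow_of_nonpos hpos hnorm.le (neg_nonpos.2 hk.le)
  have hexp : (3 - 1 / d) * (2 / p - 1) - k ≤ 0 := by
    refine nonpos_of_forall_rpow_le (C := C / (2 ^ (-k) * (J * r₀ ^ 3) ^ (2 / p - 1)))
      fun lam hlam => ?_
    have hlam0 : 0 < lam := one_pos.trans_le hlam
    rw [le_div_iff₀ (by positivity)]
    refine le_trans (le_of_eq ?_) (key lam hlam)
    rw [← mul_assoc J, Real.mul_rpow (x := J * r₀ ^ 3) (by positivity) (by positivity),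
      ← Real.rpow_mul hlam0.le, sub_eq_add_neg _ k, Real.rpow_add hlam0]
    ring
  have : (6 - 2 / d) * (1 / p - 1 / 2) = (3 - 1 / d) * (2 / p - 1) := by ring
  linarith

/-! ### Passage to the linear height -/

theorem EReal.coe_six : ((6 : ℝ) : EReal) = 6 := rfl

theorem EReal.coe_two : ((2 : ℝ) : EReal) = 2 := rfl

/-- The supremum need not be attained, so the bound is continued from `d < h` by continuity: `d ↑ h`
when `h` is finite, `d → ∞` with `2 / d → 0` when `h = ⊤`. -/
theorem EReal.mul_le_of_forall_lt {h : EReal} (hh : 0 < h) {q k : ℝ}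
    (H : ∀ d : ℝ, 0 < d → (d : EReal) < h → (6 - 2 / d) * q ≤ k) :
    (6 - 2 / h) * (q : EReal) ≤ (k : EReal) := by
  induction h with
  | bot => simp at hh
  | top =>
    have hlim : Filter.Tendsto (fun d : ℝ => (6 - 2 / d) * q) Filter.atTop (nhds ((6 - 0) * q)) :=
      (tendsto_const_nhds.sub (tendsto_const_nhds.div_atTop Filter.tendsto_id)).mul_const q
    have := le_of_tendsto hlim
      ((Filter.eventually_gt_atTop 0).mono fun d hd => H d hd (EReal.coe_lt_top d))
    rw [EReal.div_top, sub_zero]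
    rw [sub_zero] at this
    rw [← EReal.coe_six]
    exact_mod_cast this
  | coe s =>
    have hs : 0 < s := by exact_mod_cast hh
    have hlim : Filter.Tendsto (fun d : ℝ => (6 - 2 / d) * q) (nhdsWithin s (Set.Iio s))
        (nhds ((6 - 2 / s) * q)) := by
      have : ContinuousAt (fun d : ℝ => (6 - 2 / d) * q) s :=
        (continuousAt_const.sub (continuousAt_const.div continuousAt_id hs.ne')).mul_const q
      exact this.tendsto.mono_left nhdsWithin_le_nhds
    have := le_of_tendsto hlim (by
      filter_upwards [self_mem_nhdsWithin, nhdsWithin_le_nhds (lt_mem_nhds hs)] with d hd hd0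
      exact H d hd0 (by exact_mod_cast hd))
    rwa [← EReal.coe_six, ← EReal.coe_two, ← EReal.coe_div, ← EReal.coe_sub, ← EReal.coe_mul,
      EReal.coe_le_coe_iff]

theorem mainTheorem5
    (p : ℝ) (hp₁ : 1 ≤ p) (hp₂ : p ≤ 2)
    (φ : Space → ℝ) (Γ₀ : Set Space) (hΓ₀ : IsConicNhd Γ₀ !₂[0, 0, 1])
    (hφ_smooth : ContDiffOn ℝ ∞ φ Γ₀)
    (hφ_pos : ∀ ξ ∈ Γ₀, 0 < φ ξ)
    (hφ_hom : ∀ ξ ∈ Γ₀, ∀ t : ℝ, 0 < t → φ (t • ξ) = t * φ ξ)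
    (ϕ : Plane → ℝ) (U : Set Plane) (hU : IsOpen U) (h0U : (0 : Plane) ∈ U)
    (hϕ_smooth : ContDiffOn ℝ ∞ ϕ U)
    (hϕ_zero : ϕ 0 = 0) (hϕ_grad : fderiv ℝ ϕ 0 = 0)
    (hgraph : {ξ | ξ ∈ Γ₀ ∧ φ ξ = 1} = {ξ | ∃ x ∈ U, ξ = !₂[x 0, x 1, 1 + ϕ x]}) :
    (6 - 2 / linearHeight ϕ) * ((1 / p - 1 / 2 : ℝ) : EReal)
      ≤ criticalExponent φ !₂[0, 0, 1] p := by
  have hpos : 0 < linearHeight ϕ := by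
    refine lt_of_lt_of_le ?_ ((half_le_newtonDistance _).trans
      (le_iSup (fun T : Plane ≃L[ℝ] Plane => newtonDistance (ϕ ∘ T)) (.refl ℝ Plane)))
    exact_mod_cast (by norm_num : (0 : ℝ) < 1 / 2)
  refine le_iInf₂ fun k ⟨hk, Γ, hΓ, _, hbd⟩ => EReal.mul_le_of_forall_lt hpos fun d hd0 hd => ?_
  obtain ⟨T, hT⟩ := lt_iSup_iff.1 hd
  exact order_ge_of_lt_newtonDistance hp₁ hΓ₀ hφ_smooth hφ_pos hφ_hom hU h0U hϕ_smooth hϕ_zero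
    hgraph hk hΓ hbd T hd0 hT
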